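/- **Theorem (deformed hodograph formula for Burgers' equation).** Let $f$ be a smooth real function on an open set $I\subseteq\mathbb R$, and let $u=u(x,t)$ be a smooth function on an open set $U\subseteq\mathbb R^2$ with values in $I$ that satisfies the hodograph equation $$x+2ut+f(u)=0 \quad\text{on } U$$ (so that $u_x\neq 0$ and $u$ solves the Hopf equation $u_t=2uu_x$). *Quasi-Miura transformation.* Put $v^0=u$ and let $v^n$, $n\ge 1$, be determined recursively by the transport equations $$(\partial_t-\partial_x\,2u)\,v^n=\partial_x\Big(\sum_{i=1}^{n-1}v^iv^{n-i}+\partial_xv^{n-1}\Big),$$ where $v^n$ is the solution that is a polynomial in $u_x$, with coefficients polynomial in $f''(u),f'''(u),\dots$, without a term $g_n(u)u_x$ in the kernel of $\partial_t-\partial_x 2u$. (Here $u_{xx}=f''(u)u_x^3$, and $(\partial_t-\partial_x2u)(c(u)u_x^m)=2(m-1)c(u)u_x^{m+1}$.) Eliminating $f'',f''',\dots$ by $f''=u_{xx}/u_x^3$, $f^{(k+1)}=\frac1{u_x}\partial_x f^{(k)}$ gives $v^n=F_n$ with $F_n$ a polynomial in $u_x^{-1},u_x,u_{xx},\dots$ that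 does not depend on $f$. The quasi-Miura transformation of Burgers' equation is $v=u+\sum_{n\ge1}\epsilon^nF_n(u_x,u_{xx},\dots)$. *Deformed 1-form.* A deformed 1-form of $f$ for $a(u)=1$ is a formal series $\omega_f=f(u)+\sum_{n\ge1}\epsilon^n g_n(u,u_x,\dots)$, where each $g_n$ is a polynomial in $u_x,u_{xx},\dots$ with coefficients smooth functions of $u\in I$, homogeneous of degree $n$ for $\deg u_{(k)}=k$, such that $\{u^2+\epsilon u_x,\omega_f\}=0$ at every order in $\epsilon$, for the bracket $$\{\alpha,\beta\}=\sum_{j\ge0}\Big(\partial_x^{j+1}\beta\,\frac{\partial\alpha}{\partial u_{(j)}}-\partial_x^{j+1}\alpha\,\frac{\partial\beta}{\partial u_{(j)}}\Big).$$ Then: 1. $v$ is a formal solution of Burgers' equation: its coefficients are smooth on $U$, and $v_t=\partial_x(v^2+\epsilon v_x)$ holds at every order in $\epsilon$. Its first terms are $$v=u+\epsilon\frac{u_{xx}}{2u_x}+\epsilon^2\Big(\frac{u_{xxx}}{8u_x^2}-\frac{u_{xx}^2}{6u_x^3}\Big)_x+\epsilon^3\Big(\frac{u_{5x}}{48u_x^3}-\frac{u_{xx}u_{4x}}{6u_x^4}-\frac{u_{xxx}^2}{8u_x^4}+\frac{3u_{xx}^2u_{xxx}}{4u_x^5}-\frac{u_{xx}^4}{2u_x^6}\Big)_x+O(\epsilon^4).$$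 2. There is exactly one deformed 1-form $\omega_f$ of $f$ for $a(u)=1$. 3. $v$ satisfies the deformed hodograph equation $$x+2vt+\omega_f(v,v_x,v_{xx},\dots)=0$$ on $U$, as an identity of formal power series in $\epsilon$ (functions of $v$ are expanded by Taylor's formula at $u$). -/

import Mathlib

open scoped ContDiff

namespace BurgersHodograph

noncomputable section

/-! ### Smooth functions of one variable on an open set -/

/-- Extension by zero of a function on the open set `I`. -/
def zeroExt {I : TopologicalSpace.Opens ℝ} (g : I → ℝ) : ℝ → ℝ :=
  Function.extend Subtype.val g 0

theorem zeroExt_apply {I : TopologicalSpace.Opens ℝ} (g : I → ℝ) (x : I) :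
    zeroExt g x = g x :=
  Subtype.val_injective.extend_apply g 0 x

/-- A function on `I` is smooth as soon as some function on `ℝ` that is smooth on `I` restricts
to it. -/
theorem contDiffOn_zeroExt {I : TopologicalSpace.Opens ℝ} {g : I → ℝ} {G : ℝ → ℝ}
    (hG : ContDiffOn ℝ ∞ G I) (h : ∀ x : I, g x = G x) : ContDiffOn ℝ ∞ (zeroExt g) I :=
  hG.congr fun x hx => (zeroExt_apply g ⟨x, hx⟩).trans (h ⟨x, hx⟩)

/-- The algebra `C^∞(I)` of smooth real functions on the open set `I ⊆ ℝ`. -/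
def SmoothFun (I : TopologicalSpace.Opens ℝ) : Subalgebra ℝ (I → ℝ) where
  carrier := {g | ContDiffOn ℝ ∞ (zeroExt g) I}
  mul_mem' := fun {a b} ha hb => contDiffOn_zeroExt (ContDiffOn.mul ha hb) fun x => by
    simp [zeroExt_apply]
  add_mem' := fun {a b} ha hb => contDiffOn_zeroExt (ContDiffOn.add ha hb) fun x => by
    simp [zeroExt_apply]
  algebraMap_mem' := fun r =>
    contDiffOn_zeroExt (G := fun _ => r) contDiffOn_const fun _ => rfl

/-- The coordinate function `u ↦ u` on `I`. -/
def idFun (I : TopologicalSpace.Opens ℝ) : SmoothFun I :=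
  ⟨fun x => (x : ℝ), contDiffOn_zeroExt (G := fun x => x) contDiffOn_id fun _ => rfl⟩

theorem differentiableAt_zeroExt {I : TopologicalSpace.Opens ℝ} (g : SmoothFun I) (x : I) :
    DifferentiableAt ℝ (zeroExt g.1) x :=
  (g.2.contDiffAt (I.isOpen.mem_nhds x.2)).differentiableAt (by simp)

theorem deriv_zeroExt_congr {I : TopologicalSpace.Opens ℝ} {g : I → ℝ} {G : ℝ → ℝ}
    (h : ∀ x : I, g x = G x) (x : I) : deriv (zeroExt g) x = deriv G x := by
  apply Filter.EventuallyEq.deriv_eq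
  filter_upwards [I.isOpen.mem_nhds x.2] with y hy
  exact (zeroExt_apply g ⟨y, hy⟩).trans (h ⟨y, hy⟩)

/-- The derivation `g ↦ g'` of `C^∞(I)`. -/
def fderivation (I : TopologicalSpace.Opens ℝ) : Derivation ℝ (SmoothFun I) (SmoothFun I) :=
  Derivation.mk'
    { toFun := fun g => ⟨fun x => deriv (zeroExt g.1) x,
        contDiffOn_zeroExt (G := deriv (zeroExt g.1))
          (ContDiffOn.deriv_of_isOpen g.2 I.isOpen (by simp)) fun _ => rfl⟩
      map_add' := fun a b => by
        ext x
        change deriv (zeroExt (a.1 + b.1)) x = deriv (zeroExt a.1) x + deriv (zeroExt b.1) x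
        rw [← deriv_add (differentiableAt_zeroExt a x) (differentiableAt_zeroExt b x)]
        exact deriv_zeroExt_congr (fun y => by simp [zeroExt_apply]) x
      map_smul' := fun r a => by
        ext x
        change deriv (zeroExt (r • a.1)) x = r • deriv (zeroExt a.1) x
        rw [← deriv_const_smul r (differentiableAt_zeroExt a x)]
        exact deriv_zeroExt_congr (fun y => by simp [zeroExt_apply]) x }
    (fun a b => by
      ext x
      change deriv (zeroExt (a.1 * b.1)) x
        = a.1 x * deriv (zeroExt b.1) x + b.1 x * deriv (zeroExt a.1) x
      rw [deriv_zeroExt_congr (G := zeroExt a.1 * zeroExt b.1)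
          (fun y => by simp [zeroExt_apply]) x,
        deriv_mul (differentiableAt_zeroExt a x) (differentiableAt_zeroExt b x),
        zeroExt_apply, zeroExt_apply]
      ring)

/-! ### Differential polynomials, the bracket of 1-forms, the deformed 1-form -/

/-- Differential polynomials: polynomials in `u_x, u_xx, …` with coefficients smooth functions of
`u ∈ I`. The variable `X k` stands for the `(k+1)`-st derivative `u_(k+1)`. -/
abbrev DiffPoly (I : TopologicalSpace.Opens ℝ) : Type := MvPolynomial ℕ (SmoothFun I)

variable {I : TopologicalSpace.Opens ℝ}

/-- `∂P/∂u`: differentiate the coefficients. -/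
def partialU (P : DiffPoly I) : DiffPoly I :=
  ∑ m ∈ P.support, MvPolynomial.monomial m (fderivation I (P.coeff m))

/-- The total derivative `∂_x P = u_x ∂P/∂u + ∑_{k ≥ 1} u_(k+1) ∂P/∂u_(k)`. -/
def totalDeriv (P : DiffPoly I) : DiffPoly I :=
  MvPolynomial.X 0 * partialU P
    + MvPolynomial.mkDerivation (SmoothFun I)
        (fun k => (MvPolynomial.X (k + 1) : DiffPoly I)) P

/-- `∑_{j ≥ 0} (∂_x^{j+1} β) ∂α/∂u_(j)`, the derivative of `α` along the flow `u_τ = ∂_x β`. -/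
def alongFlow (β α : DiffPoly I) : DiffPoly I :=
  totalDeriv β * partialU α
    + MvPolynomial.mkDerivation (SmoothFun I) (fun k => totalDeriv^[k + 2] β) α

/-- The Poisson bracket of 1-forms
`{α, β} = ∑_j (∂_x^{j+1} β) ∂α/∂u_(j) - (∂_x^{j+1} α) ∂β/∂u_(j)`. -/
def bracket (α β : DiffPoly I) : DiffPoly I := alongFlow β α - alongFlow α β

/-- Formal 1-forms `∑_n ε^n α_n`, given by their coefficients. -/
abbrev FormalForm (I : TopologicalSpace.Opens ℝ) : Type := ℕ → DiffPoly I

/-- The bracket extended `ε`-bilinearly to formal 1-forms (coefficient of `ε^n`). -/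
def formalBracket (α β : FormalForm I) : FormalForm I := fun n =>
  ∑ ij ∈ Finset.HasAntidiagonal.antidiagonal n, bracket (α ij.1) (β ij.2)

/-- The current `u^2 + ε u_x` of Burgers' equation. -/
def burgersForm (I : TopologicalSpace.Opens ℝ) : FormalForm I
  | 0 => MvPolynomial.C (idFun I ^ 2)
  | 1 => MvPolynomial.X 0
  | _ + 2 => 0

/-- `w = f(u) + ∑_{n ≥ 1} ε^n g_n` is a deformed 1-form of `f` for the viscous central invariant
`a(u) = 1`: every `g_n` is a homogeneous differential polynomial of degree `n`, where
`deg u_(k) = k`, and `w` is in involution with `u^2 + ε u_x` at all orders in `ε`. -/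
def IsDeformedForm (f : SmoothFun I) (w : FormalForm I) : Prop :=
  w 0 = MvPolynomial.C f ∧
  (∀ n, MvPolynomial.IsWeightedHomogeneous (fun k : ℕ => k + 1) (w n) n) ∧
  ∀ n, formalBracket (burgersForm I) w n = 0

/-! ### Evaluation of a formal 1-form on a formal series -/

/-- `c(V)` for a smooth function `c` and a formal series `V = v₀ + O(ε)` with `v₀ ∈ I`:
the Taylor expansion `∑_j c^(j)(v₀) / j! (V - v₀)^j`. -/
def taylorComp (c : SmoothFun I) (V : PowerSeries ℝ) : PowerSeries ℝ :=
  (PowerSeries.mk fun j =>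
      zeroExt ((fderivation I)^[j] c).1 (PowerSeries.constantCoeff V) / (j.factorial : ℝ)).subst
    (V - PowerSeries.C (PowerSeries.constantCoeff V))

/-- The value of a differential polynomial at the formal jet `V`, where `V k` is substituted for
`u_(k)`. -/
def evalDiffPoly (P : DiffPoly I) (V : ℕ → PowerSeries ℝ) : PowerSeries ℝ :=
  ∑ m ∈ P.support, taylorComp (P.coeff m) (V 0) * m.prod fun k e => V (k + 1) ^ e

/-- The value of the formal 1-form `∑_n ε^n w_n` at the formal jet `V`. -/
def evalForm (w : FormalForm I) (V : ℕ → PowerSeries ℝ) : PowerSeries ℝ :=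
  PowerSeries.mk fun N =>
    ∑ ij ∈ Finset.HasAntidiagonal.antidiagonal N, PowerSeries.coeff ij.2 (evalDiffPoly (w ij.1) V)

/-! ### Functions of `(x, t)` and formal solutions of Burgers' equation -/

/-- `∂g/∂x` for a function of `(x, t)`. -/
def dx (g : ℝ × ℝ → ℝ) : ℝ × ℝ → ℝ := fun p => deriv (fun s => g (s, p.2)) p.1

/-- `∂g/∂t` for a function of `(x, t)`. -/
def dt (g : ℝ × ℝ → ℝ) : ℝ × ℝ → ℝ := fun p => deriv (fun s => g (p.1, s)) p.2

/-- The formal jet at `p` of the formal series `v = ∑_n ε^n v_n`: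
its `k`-th entry is `∂_x^k v = ∑_n ε^n ∂_x^k v_n`. -/
def formalJet (v : ℕ → ℝ × ℝ → ℝ) (p : ℝ × ℝ) : ℕ → PowerSeries ℝ := fun k =>
  PowerSeries.mk fun n => dx^[k] (v n) p

/-- `v = ∑_n ε^n v_n`, with smooth coefficients on `U`, solves
`v_t = ∂_x (v^2 + ε v_x)` at every order in `ε`. -/
def IsFormalBurgersSolution (U : Set (ℝ × ℝ)) (v : ℕ → ℝ × ℝ → ℝ) : Prop :=
  (∀ n, ContDiffOn ℝ ∞ (v n) U) ∧
  ∀ n, ∀ p ∈ U, dt (v n) p =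
    dx (fun q => (∑ ij ∈ Finset.HasAntidiagonal.antidiagonal n, v ij.1 q * v ij.2 q)
      + if n = 0 then 0 else dx (v (n - 1)) q) p

/-! ### The quasi-Miura transformation of Burgers' equation

For `u` given by `x + 2ut + f(u) = 0` one has `u_xx = f''(u) u_x^3`, and `L^* = ∂_t - ∂_x 2u` acts
on functions of `u` and `u_x` by `L^* (c(u) u_x^m) = 2 (m - 1) c(u) u_x^(m+1)`. -/

/-- Polynomials in `u_x` (the polynomial variable) over `ℚ[f'', f''', …]`, where `X k` stands for
`f^(k+2)(u)`. -/
abbrev HodoPoly : Type := Polynomial (MvPolynomial ℕ ℚ)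

/-- `∂/∂u` on `ℚ[f'', f''', …]`. -/
def coeffDeriv : Derivation ℚ (MvPolynomial ℕ ℚ) (MvPolynomial ℕ ℚ) :=
  MvPolynomial.mkDerivation ℚ fun k => MvPolynomial.X (k + 1)

/-- `∂_x` on polynomials in `u_x`, using `u_xx = f''(u) u_x^3`. -/
def hodoDx (P : HodoPoly) : HodoPoly :=
  Polynomial.X * (P.sum fun e c => Polynomial.monomial e (coeffDeriv c))
    + Polynomial.C (MvPolynomial.X 0) * Polynomial.X ^ 3 * Polynomial.derivative P

/-- The solution of `L^* w = P` without a term in the kernel `g(u) u_x` of `L^*`: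
`c u_x^e ↦ c u_x^(e-1) / (2 (e - 2))` (used only for `e ≥ 3`). -/
def transportInv (P : HodoPoly) : HodoPoly :=
  P.sum fun e c => Polynomial.monomial (e - 1) ((1 / (2 * ((e : ℚ) - 2))) • c)

/-- The solutions `v^n`, `n ≥ 1`, of the transport equations of Burgers' equation
`L^* v^n = ∂_x (∑_{i=1}^{n-1} v^i v^(n-i) + ∂_x v^(n-1))`, `v^0 = u`, with vanishing
integration functions `g_n(u)`. -/
def hodoCorrection : ℕ → HodoPoly
  | 0 => 0
  | n + 1 => transportInv (hodoDx
      ((∑ i : Fin n, hodoCorrection (i + 1) * hodoCorrection (n - i))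
        + if n = 0 then Polynomial.X else hodoDx (hodoCorrection n)))
  termination_by n => n
  decreasing_by all_goals omega

/-- `∂_x` on polynomials in `1/u_x, u_x, u_xx, …`; here `X 0` stands for `1/u_x` and `X k`,
`k ≥ 1`, for `u_(k)`. -/
def jetDx : Derivation ℚ (MvPolynomial ℕ ℚ) (MvPolynomial ℕ ℚ) :=
  MvPolynomial.mkDerivation ℚ fun k =>
    if k = 0 then -(MvPolynomial.X 0 ^ 2 * MvPolynomial.X 2) else MvPolynomial.X (k + 1)

/-- `f^(k+2)(u)` expressed through the derivatives of `u`: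
`f'' = u_xx / u_x^3` and `f^(k+3) = (1/u_x) ∂_x f^(k+2)`. -/
def elimF : ℕ → MvPolynomial ℕ ℚ
  | 0 => MvPolynomial.X 0 ^ 3 * MvPolynomial.X 2
  | k + 1 => MvPolynomial.X 0 * jetDx (elimF k)

/-- The coefficient `F_n(u_x, u_xx, …)`, `n ≥ 1`, of the quasi-Miura transformation
`v = u + ∑_{n ≥ 1} ε^n F_n`, obtained from `v^n` by eliminating `f'', f''', …`. -/
def quasiMiura (n : ℕ) : MvPolynomial ℕ ℚ :=
  (hodoCorrection n).eval₂
    (MvPolynomial.aeval elimF : MvPolynomial ℕ ℚ →ₐ[ℚ] MvPolynomial ℕ ℚ).toRingHom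
    (MvPolynomial.X 1)

/-- The formal series `v = u + ∑_{n ≥ 1} ε^n F_n(u_x, u_xx, …)` obtained from a function `u` of
`(x, t)` by the quasi-Miura transformation. -/
def quasiMiuraSeries (u : ℝ × ℝ → ℝ) : ℕ → ℝ × ℝ → ℝ
  | 0 => u
  | n + 1 => fun p =>
      MvPolynomial.aeval (fun k => if k = 0 then (dx u p)⁻¹ else dx^[k] u p) (quasiMiura (n + 1))

end

end BurgersHodograph

open BurgersHodograph

/-!
Everything rests on an explicit form of the deformed 1-form. Formally `ω_f = f(u + ε ∂_x) 1`, and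
since `exp (λ (u + ε ∂_x)) 1 = exp (∑_j ε^j λ^(j+1) z_j)` with `z_j = ∂_x^j u / (j + 1)!`, the
coefficient `ω_n` of `ε^n` is a universal polynomial in the `z_j` and in the derivatives of `f`
(`omega`). Euler's identity for the weights `j` of the `z_j` defines it recursively and yields the
chain rule `∂ω_n/∂z_j = ω_(n-j)`, with `f` differentiated `j + 1` times more (`derivation_omega`).
From the chain rule follows the key identity (`flow_omega_zero`, `flow_omega_succ`): if
`v_τ = ∂ (v^2 + e ∂v)`, then, up to a second order term that is moved between neighbouring degrees,
`ω_τ = 2 v ∂ω + e ∂²ω`. It is used twice.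

* With `e = 0` in the algebra of differential polynomials it says that `ω_f` is in involution with
  `u^2 + ε u_x` (`isDeformedForm_deformedForm`). Uniqueness holds because the difference of the
  first distinct coefficients of two deformed 1-forms has positive degree and is annihilated by the
  derivation `u_(j) ↦ ∂_x^(j+1) u^2 - 2 u u_(j+1)`. This derivation kills no nonzero polynomial
  without constant term, as the monomials of top degree in `u_x` show (`IsDeformedForm.unique`).
* With `e = ε`, along a formal solution `v` of Burgers' equation, it gives `Ω_t = 2 v Ω_x + ε Ω_xx`
  for `Ω = ω_f(v, v_x, …)` (`seriesDerivation_omegaSeries`).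

On the hodograph locus all functions involved are polynomials in `u_x` over `ℚ[u, f, f', …]`, the
derivations `∂_x` and `∂_t = 2 u_x^2 ∂/∂u_x + 2 u ∂_x` of this ring commute, and the solvability of
the transport equations makes the quasi-Miura series `v` a formal solution of Burgers' equation.
The left-hand side `h = x + 2vt + Ω` of the deformed hodograph equation satisfies the same linear
equation as `Ω`, that is `(∂_t - 2u ∂_x) h = 2 (v - u) h_x + ε h_xx`, where `v - u = O(ε)`. By
induction on the order in `ε`, every coefficient of `h` is therefore annihilated by `∂_t - 2u ∂_x`,
and so does not contain `u_x`. As `v - u` and all derivatives of `v` vanish at `u_x = 0`, while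
`v - u` is even divisible by `u_x^2`, `h` vanishes at `u_x = 0`, hence identically
(`formalHodograph_eq_zero`). The evaluation homomorphism `hodoEval` carries the identities of this
ring over to functions on `U`.
-/

namespace BurgersHodograph

noncomputable section

open Finset.HasAntidiagonal (antidiagonal mem_antidiagonal)

variable {I : TopologicalSpace.Opens ℝ}

/-! ### The universal deformation -/

theorem sum_antidiagonal_assoc {M : Type*} [AddCommMonoid M] (F : ℕ → ℕ → ℕ → M) (n : ℕ) :
    ∑ x ∈ antidiagonal n, ∑ y ∈ antidiagonal x.1, F y.1 y.2 x.2
      = ∑ x ∈ antidiagonal n, ∑ y ∈ antidiagonal x.2, F x.1 y.1 y.2 := by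
  rw [Finset.sum_sigma', Finset.sum_sigma']
  refine Finset.sum_bij' (fun a _ => ⟨(a.2.1, a.2.2 + a.1.2), (a.2.2, a.1.2)⟩)
    (fun a _ => ⟨(a.1.1 + a.2.1, a.2.2), (a.1.1, a.2.1)⟩) ?_ ?_ ?_ ?_ ?_ <;>
  · rintro ⟨⟨a, b⟩, ⟨c, d⟩⟩ h
    simp only [Finset.mem_sigma, mem_antidiagonal] at h ⊢
    try grind

section Universal

variable {S : Type*} [CommRing S] [Algebra ℚ S]

/-- The universal deformation `ω_n`, shifted by `k`: the coefficient of `ε^n` in the expansion of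
`exp (∑_{j ≥ 1} z_j ε^j λ^{j+1})` in powers of `λ`, with `λ^m` replaced by `c_{k+m}`. If `c_l` is
the `l`-th derivative of `f` at `v` and `z_j = ∂^j v / (j + 1)!`, this is the coefficient of `ε^n`
in `f^(k)(v + ε ∂) 1`. The recursion is Euler's identity `n ω_n = ∑_j j z_j ∂ω_n/∂z_j`; the variable
`z_0` enters only through the `c_l`. -/
def omega (c z : ℕ → S) : ℕ → ℕ → S
  | 0, k => c k
  | n + 1, k => ((n + 1 : ℚ)⁻¹) •
      ∑ j : Fin (n + 1), ((j + 1 : ℕ) : ℚ) • (omega c z (n - j) (k + j + 2) * z (j + 1))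
  termination_by n => n
  decreasing_by all_goals omega

theorem omega_zero (c z : ℕ → S) (k : ℕ) : omega c z 0 k = c k := by rw [omega]

theorem smul_omega (c z : ℕ → S) (n k : ℕ) :
    (n : ℚ) • omega c z n k
      = ∑ x ∈ antidiagonal n, (x.2 : ℚ) • (omega c z x.1 (k + x.2 + 1) * z x.2) := by
  cases n with
  | zero => simp
  | succ n =>
    rw [omega, smul_smul, Nat.cast_succ, mul_inv_cancel₀ (by positivity), one_smul,
      Finset.Nat.sum_antidiagonal_succ', ← Finset.Nat.sum_antidiagonal_swap,
      Finset.Nat.sum_antidiagonal_eq_sum_range_succ_mk, ← Fin.sum_univ_eq_sum_range (fun j => _)]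
    simp [add_assoc]

theorem omega_succ_eq (c z : ℕ → S) (n k : ℕ) :
    omega c z (n + 1) k = ((n + 1 : ℕ) : ℚ)⁻¹ •
      ∑ x ∈ antidiagonal n, ((x.2 + 1 : ℕ) : ℚ) • (omega c z x.1 (k + x.2 + 2) * z (x.2 + 1)) := by
  rw [eq_inv_smul_iff₀ (by positivity), smul_omega, Finset.Nat.sum_antidiagonal_succ']
  simp [add_assoc]

/-- Chain rule for the universal deformation: `∂ω_n/∂z_j = ω_{n-j}` with `f` differentiated
`j + 1` times. -/
theorem derivation_omega {c z : ℕ → S} (D : Derivation ℚ S S)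
    (hc : ∀ k, D (c k) = c (k + 1) * D (z 0)) (n k : ℕ) :
    D (omega c z n k) = ∑ x ∈ antidiagonal n, omega c z x.1 (k + x.2 + 1) * D (z x.2) := by
  induction n using Nat.strong_induction_on generalizing k with
  | _ n ih =>
    rcases Nat.eq_zero_or_pos n with rfl | hn
    · simp [omega_zero, hc]
    have hn' : (n : ℚ) ≠ 0 := by positivity
    have key : (n : ℚ) • D (omega c z n k)
        = (n : ℚ) • ∑ x ∈ antidiagonal n, omega c z x.1 (k + x.2 + 1) * D (z x.2) := by
      rw [← D.map_smul, smul_omega, map_sum]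
      have h1 : ∀ x ∈ antidiagonal n,
          D ((x.2 : ℚ) • (omega c z x.1 (k + x.2 + 1) * z x.2))
          = (x.2 : ℚ) • (omega c z x.1 (k + x.2 + 1) * D (z x.2))
          + ∑ y ∈ antidiagonal x.1, (x.2 : ℚ) •
              (omega c z y.1 (k + y.2 + x.2 + 2) * D (z y.2) * z x.2) := by
        rintro ⟨i, j⟩ hij
        rw [mem_antidiagonal] at hij
        dsimp only at hij ⊢
        rcases Nat.eq_zero_or_pos j with rfl | hj
        · simp
        rw [D.map_smul, D.leibniz, ih i (by omega), smul_eq_mul, smul_eq_mul, smul_add,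
          Finset.mul_sum, Finset.smul_sum]
        congr 1
        refine Finset.sum_congr rfl fun y _ => ?_
        congr 1
        rw [show k + j + 1 + y.2 + 1 = k + y.2 + j + 2 by omega]
        ring
      rw [Finset.sum_congr rfl h1, Finset.sum_add_distrib,
        sum_antidiagonal_assoc
          (fun a b d => (d : ℚ) • (omega c z a (k + b + d + 2) * D (z b) * z d)),
        Finset.smul_sum]
      -- the inner sum over `d` is collected by Euler's identity for `ω_{n-b}`
      have h2 : ∑ x ∈ antidiagonal n, ∑ y ∈ antidiagonal x.2,
            (y.2 : ℚ) • (omega c z x.1 (k + y.1 + y.2 + 2) * D (z y.1) * z y.2)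
          = ∑ x ∈ antidiagonal n, ((x.1 : ℚ) • (omega c z x.1 (k + x.2 + 1) * D (z x.2))) := by
        have h3 : ∀ x ∈ antidiagonal n, ((x.1 : ℚ) • (omega c z x.1 (k + x.2 + 1) * D (z x.2)))
            = ∑ y ∈ antidiagonal x.1, (y.2 : ℚ) •
              (omega c z y.1 (k + x.2 + y.2 + 2) * D (z x.2) * z y.2) := by
          intro x _
          rw [← smul_mul_assoc, smul_omega, Finset.sum_mul]
          refine Finset.sum_congr rfl fun y _ => ?_
          rw [show k + x.2 + 1 + y.2 + 1 = k + x.2 + y.2 + 2 by omega, smul_mul_assoc]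
          congr 1
          ring
        rw [Finset.sum_congr rfl h3, sum_antidiagonal_assoc
          (fun a d b => (d : ℚ) • (omega c z a (k + b + d + 2) * D (z b) * z d))]
        refine Finset.sum_congr rfl fun x _ => ?_
        rw [← Finset.Nat.sum_antidiagonal_swap]
        simp only [Prod.fst_swap, Prod.snd_swap]
      rw [h2, ← Finset.sum_add_distrib]
      refine Finset.sum_congr rfl fun x hx => ?_
      rw [mem_antidiagonal] at hx
      rw [← add_smul, ← hx]
      push_cast
      rw [add_comm]
    exact (smul_right_injective S hn') key

/-- The second derivative of `ω_n` is `B_n + A_{n+1}`, where `E ω_n = A_n + e B_n` for any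
derivation `E` with `E c_l = c_{l+1} E z_0` and `E z_j = ∑_{a+b+1=j} ∂z_a ∂z_b + e ∂²z_j`. Hence
formally `E (∑ e^n ω_n) = e ∂² (∑ e^n ω_n)`. -/
theorem derivation_derivation_omega {c z : ℕ → S} (D : Derivation ℚ S S)
    (hc : ∀ k, D (c k) = c (k + 1) * D (z 0)) (n k : ℕ) :
    D (D (omega c z n k)) = ∑ x ∈ antidiagonal n, omega c z x.1 (k + x.2 + 1) * D (D (z x.2))
      + ∑ x ∈ antidiagonal n, omega c z x.1 (k + x.2 + 2)
          * ∑ y ∈ antidiagonal x.2, D (z y.1) * D (z y.2) := by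
  rw [derivation_omega D hc, map_sum]
  simp only [D.leibniz, smul_eq_mul, Finset.sum_add_distrib]
  congr 1
  simp only [derivation_omega D hc, Finset.mul_sum]
  have h : ∀ x ∈ antidiagonal n, ∀ y ∈ antidiagonal x.2,
      omega c z x.1 (k + x.2 + 2) * (D (z y.1) * D (z y.2))
        = omega c z x.1 (k + (y.1 + y.2) + 2) * (D (z y.1) * D (z y.2)) := by
    intro x _ y hy
    rw [mem_antidiagonal] at hy
    rw [hy]
  rw [Finset.sum_congr rfl fun x hx => Finset.sum_congr rfl (h x hx), ← sum_antidiagonal_assoc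
    (fun a b d => omega c z a (k + (b + d) + 2) * (D (z b) * D (z d)))]
  refine Finset.sum_congr rfl fun x _ => Finset.sum_congr rfl fun y _ => ?_
  rw [show k + x.2 + 1 + y.2 + 1 = k + (y.2 + x.2) + 2 by omega]
  ring

end Universal

/-! ### The universal deformation along a flow -/

section Jets

variable {S : Type*} [CommRing S] [Algebra ℚ S]

/-- `∂^j v / (j + 1)!`, the argument of the universal deformation `omega`. -/
def scaledJet (D : Derivation ℚ S S) (v : S) (j : ℕ) : S := ((j + 1).factorial : ℚ)⁻¹ • D^[j] v

theorem scaledJet_zero (D : Derivation ℚ S S) (v : S) : scaledJet D v 0 = v := by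
  simp [scaledJet]

theorem derivation_scaledJet (D : Derivation ℚ S S) (v : S) (j : ℕ) :
    D (scaledJet D v j) = ((j + 1).factorial : ℚ)⁻¹ • D^[j + 1] v := by
  rw [scaledJet, D.map_smul, Function.iterate_succ_apply']

/-- Leibniz' rule for an iterated derivation, in divided form. -/
theorem iterate_derivation_mul (D : Derivation ℚ S S) (a b : S) (n : ℕ) :
    (n.factorial : ℚ)⁻¹ • D^[n] (a * b) = ∑ x ∈ antidiagonal n,
      ((x.1.factorial : ℚ)⁻¹ • D^[x.1] a) * ((x.2.factorial : ℚ)⁻¹ • D^[x.2] b) := by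
  have h : D^[n] (a * b)
      = ∑ x ∈ antidiagonal n, (n.choose x.1) • (D^[x.1] a * D^[x.2] b) := by
    induction n with
    | zero => simp
    | succ n ih =>
      rw [Finset.sum_antidiagonal_choose_succ_nsmul (fun i j => D^[i] a * D^[j] b) n]
      simp only [Function.iterate_succ_apply', ih, map_sum, map_nsmul, D.leibniz, smul_add,
        Finset.sum_add_distrib, smul_eq_mul]
      congr 1
      refine Finset.sum_congr rfl fun x hx => ?_
      rw [n.choose_symm_of_eq_add (mem_antidiagonal.1 hx).symm, mul_comm]
  rw [h, Finset.smul_sum]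
  refine Finset.sum_congr rfl fun x hx => ?_
  rw [mem_antidiagonal] at hx
  have h1 : ((n.choose x.1 : ℕ) : ℚ) * (x.1.factorial * x.2.factorial) = n.factorial := by
    rw [← hx, ← Nat.add_choose_mul_factorial_mul_factorial, Nat.choose_symm_add]
    push_cast
    rw [mul_assoc]
  rw [smul_mul_smul_comm, ← Nat.cast_smul_eq_nsmul ℚ, smul_smul]
  congr 1
  rw [← h1]
  have : ((n.choose x.1 : ℕ) : ℚ) ≠ 0 := by
    have := Nat.choose_pos (show x.1 ≤ n by omega)
    positivity
  field_simp

theorem iterate_derivation_sq_zero (D : Derivation ℚ S S) (v : S) :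
    ((0 + 1).factorial : ℚ)⁻¹ • D^[0 + 1] (v * v) - 2 * v * D (scaledJet D v 0) = 0 := by
  rw [scaledJet_zero]
  simp
  ring

theorem iterate_derivation_sq_succ (D : Derivation ℚ S S) (v : S) (s : ℕ) :
    ((s + 1 + 1).factorial : ℚ)⁻¹ • D^[s + 1 + 1] (v * v) - 2 * v * D (scaledJet D v (s + 1))
      = ∑ y ∈ antidiagonal s, D (scaledJet D v y.1) * D (scaledJet D v y.2) := by
  rw [iterate_derivation_mul, Finset.Nat.sum_antidiagonal_succ, Finset.Nat.sum_antidiagonal_succ']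
  simp only [derivation_scaledJet]
  simp only [Nat.factorial_zero, Nat.cast_one, inv_one, one_smul, Function.iterate_zero, id_eq]
  ring

/-- The second order part of the action of a flow on `ω_n`. -/
def flowRemainder (D : Derivation ℚ S S) (c : ℕ → S) (v : S) (n k : ℕ) : S :=
  ∑ x ∈ antidiagonal n, omega c (scaledJet D v) x.1 (k + x.2 + 1) * D (D (scaledJet D v x.2))

variable {D T : Derivation ℚ S S} {c : ℕ → S} {v e : S}

theorem flow_omega_eq (hT : ∀ j, T (D^[j] v) = D^[j + 1] (v * v) + e * D^[j + 2] v)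
    (hcD : ∀ k, D (c k) = c (k + 1) * D v) (hcT : ∀ k, T (c k) = c (k + 1) * T v) (n k : ℕ) :
    T (omega c (scaledJet D v) n k) - 2 * v * D (omega c (scaledJet D v) n k)
      = ∑ x ∈ antidiagonal n, omega c (scaledJet D v) x.1 (k + x.2 + 1) *
          (((x.2 + 1).factorial : ℚ)⁻¹ • D^[x.2 + 1] (v * v) - 2 * v * D (scaledJet D v x.2))
        + e * flowRemainder D c v n k := by
  rw [derivation_omega T (by simpa only [scaledJet_zero] using hcT),
    derivation_omega D (by simpa only [scaledJet_zero] using hcD), flowRemainder,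
    Finset.mul_sum, Finset.mul_sum, ← Finset.sum_sub_distrib, ← Finset.sum_add_distrib]
  refine Finset.sum_congr rfl fun x _ => ?_
  have h1 : T (scaledJet D v x.2) = ((x.2 + 1).factorial : ℚ)⁻¹ • D^[x.2 + 1] (v * v)
      + e * D (D (scaledJet D v x.2)) := by
    rw [derivation_scaledJet, D.map_smul, ← Function.iterate_succ_apply' D, scaledJet,
      T.map_smul, hT, smul_add, mul_smul_comm]
  rw [h1]
  ring

theorem flow_omega_zero (hT : ∀ j, T (D^[j] v) = D^[j + 1] (v * v) + e * D^[j + 2] v)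
    (hcD : ∀ k, D (c k) = c (k + 1) * D v) (hcT : ∀ k, T (c k) = c (k + 1) * T v) (k : ℕ) :
    T (omega c (scaledJet D v) 0 k) = 2 * v * D (omega c (scaledJet D v) 0 k)
      + e * flowRemainder D c v 0 k := by
  have h := flow_omega_eq hT hcD hcT 0 k
  rw [Finset.Nat.antidiagonal_zero, Finset.sum_singleton, iterate_derivation_sq_zero] at h
  linear_combination h

/-- If `v_τ = ∂ (v^2 + e ∂v)`, then the coefficients of `ω` satisfy, degree by degree, the equation
`ω_τ = 2 v ∂ω + e ∂²ω`, up to the redistribution of the second order part between neighbouring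
degrees. -/
theorem flow_omega_succ (hT : ∀ j, T (D^[j] v) = D^[j + 1] (v * v) + e * D^[j + 2] v)
    (hcD : ∀ k, D (c k) = c (k + 1) * D v) (hcT : ∀ k, T (c k) = c (k + 1) * T v) (n k : ℕ) :
    T (omega c (scaledJet D v) (n + 1) k) = 2 * v * D (omega c (scaledJet D v) (n + 1) k)
      + (D (D (omega c (scaledJet D v) n k)) - flowRemainder D c v n k)
      + e * flowRemainder D c v (n + 1) k := by
  have h := flow_omega_eq hT hcD hcT (n + 1) k
  rw [Finset.Nat.sum_antidiagonal_succ', iterate_derivation_sq_zero] at h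
  simp only [iterate_derivation_sq_succ] at h
  have h2 := derivation_derivation_omega D (z := scaledJet D v)
    (by simpa only [scaledJet_zero] using hcD) n k
  rw [flowRemainder]
  simp only [← add_assoc] at h h2
  linear_combination h - h2

end Jets

/-! ### Derivations of differential polynomials -/

/-- The derivations of a commutative `ℚ`-algebra, with the module structure of the algebra. -/
abbrev RatDerivation (S : Type*) [CommRing S] [Algebra ℚ S] := Derivation ℚ S S

section Generic

variable {R : Type*} [CommRing R] [Algebra ℚ R]

theorem coeff_sum_monomial (d : Derivation ℚ R R) (P : MvPolynomial ℕ R) (m : ℕ →₀ ℕ) :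
    (∑ l ∈ P.support, MvPolynomial.monomial l (d (P.coeff l))).coeff m = d (P.coeff m) := by
  classical
  rw [MvPolynomial.coeff_sum]
  simp only [MvPolynomial.coeff_monomial]
  rw [Finset.sum_ite_eq']
  split_ifs with h
  · rfl
  · rw [MvPolynomial.notMem_support_iff.1 h, map_zero]

/-- The extension of a derivation `d` of `R` to `R[u_x, u_xx, …]` that acts on the coefficients. -/
def mapCoeffDerivation (d : Derivation ℚ R R) :
    RatDerivation (MvPolynomial ℕ R) :=
  Derivation.mk'
    { toFun := fun P => ∑ l ∈ P.support, MvPolynomial.monomial l (d (P.coeff l))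
      map_add' := fun P Q => by
        ext1 m
        rw [MvPolynomial.coeff_add, coeff_sum_monomial, coeff_sum_monomial, coeff_sum_monomial,
          MvPolynomial.coeff_add, map_add]
      map_smul' := fun r P => by
        ext1 m
        rw [RingHom.id_apply, MvPolynomial.coeff_smul, coeff_sum_monomial, coeff_sum_monomial,
          MvPolynomial.coeff_smul, d.map_smul] }
    (fun P Q => by
      classical
      ext1 m
      simp only [LinearMap.coe_mk, AddHom.coe_mk, smul_eq_mul]
      rw [mul_comm Q, MvPolynomial.coeff_add, coeff_sum_monomial, MvPolynomial.coeff_mul, map_sum,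
        MvPolynomial.coeff_mul, MvPolynomial.coeff_mul, ← Finset.sum_add_distrib]
      refine Finset.sum_congr rfl fun x _ => ?_
      rw [Derivation.leibniz, coeff_sum_monomial, coeff_sum_monomial, smul_eq_mul, smul_eq_mul]
      ring)

/-- The sum of `a E`, for a derivation `E` of `R[u_x, u_xx, …]`, and the `R`-linear derivation with
values `g` on the variables. -/
def smulAddMkDerivation (a : MvPolynomial ℕ R)
    (E : RatDerivation (MvPolynomial ℕ R)) (g : ℕ → MvPolynomial ℕ R) :
    RatDerivation (MvPolynomial ℕ R) :=
  a • E + (MvPolynomial.mkDerivation R g).restrictScalars ℚ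

end Generic

theorem coeff_partialU (P : DiffPoly I) (m : ℕ →₀ ℕ) :
    (partialU P).coeff m = fderivation I (P.coeff m) :=
  coeff_sum_monomial ((fderivation I).restrictScalars ℚ) P m

/-- `∂/∂u` as a derivation of the algebra of differential polynomials. -/
def partialUDerivation (I : TopologicalSpace.Opens ℝ) : RatDerivation (DiffPoly I) :=
  mapCoeffDerivation ((fderivation I).restrictScalars ℚ)

/-- The total derivative `∂_x` as a derivation. -/
def totalDerivation (I : TopologicalSpace.Opens ℝ) : RatDerivation (DiffPoly I) :=
  smulAddMkDerivation (MvPolynomial.X 0) (partialUDerivation I) fun k => MvPolynomial.X (k + 1)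

theorem totalDerivation_apply (P : DiffPoly I) : totalDerivation I P = totalDeriv P := rfl

theorem coe_totalDerivation : ⇑(totalDerivation I) = totalDeriv := rfl

/-- The derivative along the flow `u_τ = ∂_x β` as a derivation. -/
def flowDerivation (β : DiffPoly I) : RatDerivation (DiffPoly I) :=
  smulAddMkDerivation (totalDeriv β) (partialUDerivation I) fun k => totalDeriv^[k + 2] β

theorem flowDerivation_apply (β P : DiffPoly I) : flowDerivation β P = alongFlow β P := rfl

theorem partialU_C (g : SmoothFun I) :
    partialU (MvPolynomial.C g) = MvPolynomial.C (fderivation I g) := by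
  classical
  ext1 m
  simp only [coeff_partialU, MvPolynomial.coeff_C]
  split_ifs <;> simp

theorem partialU_X (k : ℕ) : partialU (MvPolynomial.X k : DiffPoly I) = 0 := by
  classical
  ext1 m
  simp only [coeff_partialU, MvPolynomial.coeff_X, MvPolynomial.coeff_zero]
  split_ifs <;> simp

theorem fderivation_idFun : fderivation I (idFun I) = 1 := by
  ext x
  change deriv (zeroExt (idFun I).1) x = 1
  rw [deriv_zeroExt_congr (G := id) (g := (idFun I).1) (fun _ => rfl), deriv_id]

theorem totalDeriv_C (g : SmoothFun I) : totalDeriv (MvPolynomial.C g)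
    = MvPolynomial.X 0 * MvPolynomial.C (fderivation I g) := by
  rw [totalDeriv, partialU_C, MvPolynomial.derivation_C, add_zero]

theorem totalDeriv_X (k : ℕ) :
    totalDeriv (MvPolynomial.X k : DiffPoly I) = MvPolynomial.X (k + 1) := by
  rw [totalDeriv, partialU_X, MvPolynomial.mkDerivation_X, mul_zero, zero_add]

theorem alongFlow_C (β : DiffPoly I) (g : SmoothFun I) : alongFlow β (MvPolynomial.C g)
    = totalDeriv β * MvPolynomial.C (fderivation I g) := by
  rw [alongFlow, partialU_C, MvPolynomial.derivation_C, add_zero]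

theorem alongFlow_X (β : DiffPoly I) (k : ℕ) :
    alongFlow β (MvPolynomial.X k) = totalDeriv^[k + 2] β := by
  rw [alongFlow, partialU_X, MvPolynomial.mkDerivation_X, mul_zero, zero_add]

theorem iterate_totalDeriv_X (j k : ℕ) :
    totalDeriv^[j] (MvPolynomial.X k : DiffPoly I) = MvPolynomial.X (k + j) := by
  induction j with
  | zero => rfl
  | succ j ih => rw [Function.iterate_succ_apply', ih, totalDeriv_X, add_assoc]

theorem totalDeriv_u : totalDeriv (MvPolynomial.C (idFun I)) = MvPolynomial.X 0 := by
  rw [totalDeriv_C, fderivation_idFun, map_one, mul_one]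

theorem iterate_totalDeriv_u (j : ℕ) :
    totalDeriv^[j + 1] (MvPolynomial.C (idFun I)) = MvPolynomial.X j := by
  rw [Function.iterate_succ_apply, totalDeriv_u, iterate_totalDeriv_X, zero_add]

theorem alongFlow_iterate_u (β : DiffPoly I) (j : ℕ) :
    alongFlow β (totalDeriv^[j] (MvPolynomial.C (idFun I))) = totalDeriv^[j + 1] β := by
  cases j with
  | zero => rw [Function.iterate_zero, id, alongFlow_C, fderivation_idFun, map_one, mul_one]; rfl
  | succ j => rw [iterate_totalDeriv_u, alongFlow_X]

/-! ### The deformed 1-form -/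

/-- The derivatives of `f`, as differential polynomials. -/
def coeffSeq (f : SmoothFun I) (k : ℕ) : DiffPoly I := MvPolynomial.C ((fderivation I)^[k] f)

/-- The deformed 1-form of `f`: formally `f(u + ε ∂_x) 1`. -/
def deformedForm (f : SmoothFun I) : FormalForm I := fun n =>
  omega (coeffSeq f) (scaledJet (totalDerivation I) (MvPolynomial.C (idFun I))) n 0

theorem totalDeriv_coeffSeq (f : SmoothFun I) (k : ℕ) : totalDerivation I (coeffSeq f k)
    = coeffSeq f (k + 1) * totalDerivation I (MvPolynomial.C (idFun I)) := by
  rw [totalDerivation_apply, totalDerivation_apply, totalDeriv_u, coeffSeq, totalDeriv_C,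
    ← Function.iterate_succ_apply' (fderivation I), mul_comm, coeffSeq]

theorem flowDerivation_coeffSeq (β : DiffPoly I) (f : SmoothFun I) (k : ℕ) :
    flowDerivation β (coeffSeq f k)
      = coeffSeq f (k + 1) * flowDerivation β (MvPolynomial.C (idFun I)) := by
  rw [flowDerivation_apply, flowDerivation_apply, coeffSeq, alongFlow_C, alongFlow_C,
    fderivation_idFun, map_one, mul_one, ← Function.iterate_succ_apply' (fderivation I), mul_comm,
    coeffSeq]

theorem bracket_sq (P : DiffPoly I) : bracket (MvPolynomial.C (idFun I ^ 2)) P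
    = 2 * MvPolynomial.C (idFun I) * totalDeriv P
      - alongFlow (MvPolynomial.C (idFun I ^ 2)) P := by
  rw [bracket, alongFlow_C, Derivation.leibniz_pow, fderivation_idFun]
  simp only [Nat.add_one_sub_one, pow_one, smul_eq_mul, mul_one, nsmul_eq_mul, map_mul,
    map_natCast]
  push_cast
  ring

theorem bracket_X (P : DiffPoly I) : bracket (MvPolynomial.X 0) P
    = totalDeriv (totalDeriv P) - alongFlow (MvPolynomial.X 0) P := by
  rw [bracket, alongFlow_X]
  rfl

theorem bracket_zero_left (P : DiffPoly I) : bracket 0 P = 0 := by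
  have h : ∀ k, totalDeriv^[k] (0 : DiffPoly I) = 0 := fun k => by
    rw [← coe_totalDerivation]
    exact iterate_map_zero _ k
  have h1 : alongFlow (0 : DiffPoly I) P = 0 := by
    have h2 : MvPolynomial.mkDerivation (SmoothFun I) (fun _ : ℕ => (0 : DiffPoly I)) = 0 :=
      MvPolynomial.derivation_ext fun i => by simp
    rw [alongFlow]
    simp only [h]
    rw [h2, ← totalDerivation_apply]
    simp
  rw [bracket, h1, ← flowDerivation_apply, map_zero, sub_self]

theorem formalBracket_burgersForm_zero (w : FormalForm I) : formalBracket (burgersForm I) w 0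
    = 2 * MvPolynomial.C (idFun I) * totalDeriv (w 0)
      - alongFlow (MvPolynomial.C (idFun I ^ 2)) (w 0) := by
  rw [formalBracket, Finset.Nat.antidiagonal_zero, Finset.sum_singleton, burgersForm, bracket_sq]

theorem formalBracket_burgersForm_succ (w : FormalForm I) (n : ℕ) :
    formalBracket (burgersForm I) w (n + 1)
      = 2 * MvPolynomial.C (idFun I) * totalDeriv (w (n + 1))
        - alongFlow (MvPolynomial.C (idFun I ^ 2)) (w (n + 1))
        + (totalDeriv (totalDeriv (w n)) - alongFlow (MvPolynomial.X 0) (w n)) := by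
  rw [formalBracket, Finset.Nat.sum_antidiagonal_succ, burgersForm, bracket_sq]
  congr 1
  rw [← bracket_X]
  cases n with
  | zero => simp [burgersForm]
  | succ n => simp [Finset.Nat.sum_antidiagonal_succ, burgersForm, bracket_zero_left]

theorem alongFlow_X_deformedForm (f : SmoothFun I) (n : ℕ) :
    alongFlow (MvPolynomial.X 0) (deformedForm f n)
      = flowRemainder (totalDerivation I) (coeffSeq f) (MvPolynomial.C (idFun I)) n 0 := by
  rw [← flowDerivation_apply, deformedForm,
    derivation_omega (S := DiffPoly I) (flowDerivation (MvPolynomial.X 0)) (fun k => by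
      rw [scaledJet_zero, flowDerivation_coeffSeq]), flowRemainder]
  refine Finset.sum_congr rfl fun x _ => ?_
  congr 1
  rw [derivation_scaledJet (S := DiffPoly I), Derivation.map_smul, scaledJet, Derivation.map_smul,
    flowDerivation_apply, coe_totalDerivation, alongFlow_iterate_u,
    ← Function.iterate_succ_apply' totalDeriv, ← totalDeriv_u, ← Function.iterate_succ_apply]

theorem formalBracket_deformedForm (f : SmoothFun I) (n : ℕ) :
    formalBracket (burgersForm I) (deformedForm f) n = 0 := by
  have hT : ∀ j, flowDerivation (MvPolynomial.C (idFun I ^ 2))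
      ((totalDerivation I)^[j] (MvPolynomial.C (idFun I)))
      = (totalDerivation I)^[j + 1] (MvPolynomial.C (idFun I) * MvPolynomial.C (idFun I))
        + 0 * (totalDerivation I)^[j + 2] (MvPolynomial.C (idFun I)) := fun j => by
    rw [flowDerivation_apply, coe_totalDerivation, alongFlow_iterate_u, zero_mul, add_zero, sq,
      map_mul]
  cases n with
  | zero =>
    have h := flow_omega_zero (S := DiffPoly I) hT (totalDeriv_coeffSeq f)
      (flowDerivation_coeffSeq (MvPolynomial.C (idFun I ^ 2)) f) 0
    rw [formalBracket_burgersForm_zero, ← flowDerivation_apply, ← totalDerivation_apply,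
      deformedForm, h]
    ring
  | succ n =>
    have h := flow_omega_succ (S := DiffPoly I) hT (totalDeriv_coeffSeq f)
      (flowDerivation_coeffSeq (MvPolynomial.C (idFun I ^ 2)) f) n 0
    rw [formalBracket_burgersForm_succ, alongFlow_X_deformedForm, ← flowDerivation_apply]
    simp only [← totalDerivation_apply]
    simp only [deformedForm]
    rw [h]
    ring

theorem isWeightedHomogeneous_smul {n : ℕ} {P : DiffPoly I} (r : ℚ)
    (hP : P.IsWeightedHomogeneous (fun k : ℕ => k + 1) n) :
    (r • P).IsWeightedHomogeneous (fun k : ℕ => k + 1) n := by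
  intro m hm
  refine hP fun h => hm ?_
  rw [MvPolynomial.coeff_smul, h, smul_zero]

theorem isWeightedHomogeneous_omega (f : SmoothFun I) (n k : ℕ) :
    (omega (coeffSeq f) (scaledJet (totalDerivation I) (MvPolynomial.C (idFun I))) n k
      ).IsWeightedHomogeneous (fun k : ℕ => k + 1) n := by
  induction n using Nat.strong_induction_on generalizing k with
  | _ n ih =>
    cases n with
    | zero => rw [omega_zero]; exact MvPolynomial.isWeightedHomogeneous_C _ _
    | succ n =>
      rw [omega_succ_eq]
      refine isWeightedHomogeneous_smul _
        (MvPolynomial.IsWeightedHomogeneous.sum _ _ _ fun x hx => ?_)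
      rw [mem_antidiagonal] at hx
      refine isWeightedHomogeneous_smul _ ?_
      rw [← hx, add_assoc x.1]
      refine (ih x.1 (by omega) _).mul ?_
      rw [scaledJet, coe_totalDerivation, iterate_totalDeriv_u]
      exact isWeightedHomogeneous_smul _ (MvPolynomial.isWeightedHomogeneous_X _ _ _)

theorem isDeformedForm_deformedForm (f : SmoothFun I) : IsDeformedForm f (deformedForm f) :=
  ⟨omega_zero _ _ _, fun n => isWeightedHomogeneous_omega f n 0, formalBracket_deformedForm f⟩

/-! ### Uniqueness of the deformed 1-form -/

section Kernel

variable {R : Type*} [CommRing R]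

theorem mkDerivation_sub_mul (a : MvPolynomial ℕ R) (d d' : ℕ → MvPolynomial ℕ R)
    (P : MvPolynomial ℕ R) : MvPolynomial.mkDerivation R (fun k => d k - a * d' k) P
      = MvPolynomial.mkDerivation R d P - a * MvPolynomial.mkDerivation R d' P := by
  have h : MvPolynomial.mkDerivation R (fun k => d k - a * d' k)
      = MvPolynomial.mkDerivation R d - a • MvPolynomial.mkDerivation R d' :=
    MvPolynomial.derivation_ext fun i => by
      simp only [Derivation.sub_apply, Derivation.smul_apply, MvPolynomial.mkDerivation_X,
        smul_eq_mul]
  rw [h]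
  rfl

theorem degreeOf_mkDerivation_le {r : ℕ → MvPolynomial ℕ R}
    (hr : ∀ j, (r j).degreeOf 0 = 0) (P : MvPolynomial ℕ R) :
    (MvPolynomial.mkDerivation R r P).degreeOf 0 ≤ P.degreeOf 0 := by
  classical
  have h : MvPolynomial.mkDerivation R r P
      = ∑ s ∈ P.support, MvPolynomial.mkDerivation R r (MvPolynomial.monomial s (P.coeff s)) := by
    rw [← map_sum, MvPolynomial.support_sum_monomial_coeff]
  rw [h]
  refine (MvPolynomial.degreeOf_sum_le _ _ _).trans (Finset.sup_le fun s hs => ?_)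
  rw [MvPolynomial.mkDerivation_monomial, MvPolynomial.smul_eq_C_mul]
  refine (MvPolynomial.degreeOf_C_mul_le _ _ _).trans ?_
  refine (MvPolynomial.degreeOf_sum_le _ _ _).trans (Finset.sup_le fun i _ => ?_)
  dsimp only
  rw [smul_eq_mul]
  refine (MvPolynomial.degreeOf_mul_le _ _ _).trans ?_
  rw [hr, add_zero, MvPolynomial.degreeOf_le_iff]
  intro m hm
  have hm' := MvPolynomial.support_monomial_subset hm
  rw [Finset.mem_singleton] at hm'
  rw [hm']
  refine le_trans ?_ (MvPolynomial.monomial_le_degreeOf 0 hs)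
  rw [Finsupp.tsub_apply]
  exact Nat.sub_le _ _

variable [Algebra ℚ R]

theorem coeff_mkDerivation_smul_X (l : ℕ → ℚ) (P : MvPolynomial ℕ R) (m : ℕ →₀ ℕ) :
    (MvPolynomial.mkDerivation R (fun j => l j • (MvPolynomial.X j : MvPolynomial ℕ R)) P).coeff m
      = (m.sum fun j e => (e : ℚ) * l j) • P.coeff m := by
  classical
  induction P using MvPolynomial.induction_on' with
  | add p q hp hq => rw [map_add, MvPolynomial.coeff_add, hp, hq, MvPolynomial.coeff_add, smul_add]
  | monomial s r =>
    have h : MvPolynomial.mkDerivation R (fun j => l j • (MvPolynomial.X j : MvPolynomial ℕ R))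
        (MvPolynomial.monomial s r)
        = (s.sum fun j e => (e : ℚ) * l j) • MvPolynomial.monomial s r := by
      rw [MvPolynomial.mkDerivation_monomial, Finsupp.sum, Finsupp.sum, Finset.sum_smul,
        Finset.smul_sum]
      refine Finset.sum_congr rfl fun i hi => ?_
      have hs : s - Finsupp.single i 1 + Finsupp.single i 1 = s :=
        tsub_add_cancel_of_le (Finsupp.single_le_iff.2
          (Nat.one_le_iff_ne_zero.2 (Finsupp.mem_support_iff.1 hi)))
      rw [smul_eq_mul, MvPolynomial.X, mul_smul_comm, MvPolynomial.monomial_mul, hs, mul_one,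
        MvPolynomial.smul_monomial, MvPolynomial.smul_monomial, MvPolynomial.smul_monomial,
        smul_eq_mul]
      congr 1
      rw [mul_smul_comm, mul_comm, mul_smul, ← nsmul_eq_mul, ← Nat.cast_smul_eq_nsmul ℚ, smul_comm]
    rw [h, MvPolynomial.coeff_smul, MvPolynomial.coeff_monomial]
    split_ifs with hm
    · rw [hm]
    · rw [smul_zero, smul_zero]

/-- A derivation with `u_(j) ↦ l_j u_x u_(j) + r_j`, where `l_j > 0` and `r_j` does not contain
`u_x`, is injective on polynomials without constant term: look at the monomials of top degree in
`u_x`. -/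
theorem eq_zero_of_mkDerivation_eq_zero {e r : ℕ → MvPolynomial ℕ R} {l : ℕ → ℚ}
    (hl : ∀ j, 0 < l j) (hr : ∀ j, (r j).degreeOf 0 = 0)
    (he : ∀ j, e j = l j • (MvPolynomial.X 0 * MvPolynomial.X j) + r j)
    {P : MvPolynomial ℕ R} (hP : MvPolynomial.mkDerivation R e P = 0) (h0 : P.coeff 0 = 0) :
    P = 0 := by
  classical
  by_contra hne
  obtain ⟨m, hm, hmax⟩ := Finset.exists_max_image P.support (fun m => m 0)
    (MvPolynomial.support_nonempty.2 hne)
  have hsplit : MvPolynomial.mkDerivation R e P = MvPolynomial.X 0 *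
      MvPolynomial.mkDerivation R (fun j => l j • (MvPolynomial.X j : MvPolynomial ℕ R)) P
      + MvPolynomial.mkDerivation R r P := by
    have h : MvPolynomial.mkDerivation R e = (MvPolynomial.X 0 : MvPolynomial ℕ R) •
        MvPolynomial.mkDerivation R (fun j => l j • (MvPolynomial.X j : MvPolynomial ℕ R))
        + MvPolynomial.mkDerivation R r := MvPolynomial.derivation_ext fun i => by
      simp only [Derivation.add_apply, Derivation.smul_apply, MvPolynomial.mkDerivation_X, he,
        smul_eq_mul, mul_smul_comm]
    rw [h]
    rfl
  have hc := congrArg (MvPolynomial.coeff (m + Finsupp.single 0 1)) (hsplit.symm.trans hP)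
  have hrest : (MvPolynomial.mkDerivation R r P).coeff (m + Finsupp.single 0 1) = 0 := by
    by_contra hcon
    have h1 := MvPolynomial.monomial_le_degreeOf 0 (MvPolynomial.mem_support_iff.2 hcon)
    have h2 := (degreeOf_mkDerivation_le hr P).trans
      (MvPolynomial.degreeOf_le_iff.2 fun m' hm' => hmax m' hm')
    simp at h1
    omega
  rw [MvPolynomial.coeff_add, hrest, add_zero, add_comm m, MvPolynomial.coeff_X_mul,
    coeff_mkDerivation_smul_X, MvPolynomial.coeff_zero] at hc
  have hpos : 0 < m.sum fun j e => (e : ℚ) * l j := by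
    have hm0 : m ≠ 0 := fun h => MvPolynomial.mem_support_iff.1 hm (h ▸ h0)
    refine Finset.sum_pos (fun j hj => ?_) (Finsupp.support_nonempty_iff.2 hm0)
    have := Nat.pos_of_ne_zero (Finsupp.mem_support_iff.1 hj)
    have := hl j
    positivity
  exact MvPolynomial.mem_support_iff.1 hm
    (smul_right_injective R hpos.ne' (hc.trans (smul_zero _).symm))

/-- A derivation that maps every `u_(j)` to a quadratic form `∑_{a + b = j + 1} κ_{ab} u_(a) u_(b)`
with positive coefficients is injective on polynomials without constant term. -/
theorem eq_zero_of_mkDerivation_quadratic {κ : ℕ → ℕ × ℕ → ℚ} (hκ : ∀ j x, 0 < κ j x)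
    {P : MvPolynomial ℕ R} (hP : MvPolynomial.mkDerivation R (fun j => ∑ x ∈ antidiagonal j,
      κ j x • (MvPolynomial.X x.1 * MvPolynomial.X x.2 : MvPolynomial ℕ R)) P = 0)
    (h0 : P.coeff 0 = 0) : P = 0 := by
  classical
  -- the terms of the quadratic form that contain `u_x` are those with `a = 1` or `b = 1`
  refine eq_zero_of_mkDerivation_eq_zero
    (l := fun j => ∑ x ∈ (antidiagonal j).filter (fun x => x.1 = 0 ∨ x.2 = 0), κ j x)
    (r := fun j => ∑ x ∈ (antidiagonal j).filter (fun x => ¬ (x.1 = 0 ∨ x.2 = 0)),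
      κ j x • (MvPolynomial.X x.1 * MvPolynomial.X x.2 : MvPolynomial ℕ R)) ?_ ?_ ?_ hP h0
  · intro j
    refine Finset.sum_pos (fun x _ => hκ j x) ⟨(0, j), ?_⟩
    simp
  · intro j
    refine Nat.le_zero.1 ((MvPolynomial.degreeOf_sum_le _ _ _).trans (Finset.sup_le fun x hx => ?_))
    rw [Finset.mem_filter, not_or] at hx
    rw [← algebraMap_smul R (κ j x), MvPolynomial.smul_eq_C_mul]
    refine (MvPolynomial.degreeOf_C_mul_le _ _ _).trans
      ((MvPolynomial.degreeOf_mul_le _ _ _).trans ?_)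
    rcases subsingleton_or_nontrivial R with hs | hs
    · simp [Subsingleton.elim (MvPolynomial.X _ : MvPolynomial ℕ R) 0]
    · rw [MvPolynomial.degreeOf_X_of_ne (Ne.symm hx.2.1),
        MvPolynomial.degreeOf_X_of_ne (Ne.symm hx.2.2)]
  · intro j
    rw [← Finset.sum_filter_add_sum_filter_not _ (fun x : ℕ × ℕ => x.1 = 0 ∨ x.2 = 0),
      Finset.sum_smul]
    congr 1
    refine Finset.sum_congr rfl fun x hx => ?_
    rw [Finset.mem_filter, mem_antidiagonal] at hx
    obtain ⟨hx, h0 | h0⟩ := hx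
    · rw [show x.2 = j by omega, h0]
    · rw [show x.1 = j by omega, h0, mul_comm (MvPolynomial.X 0)]

end Kernel

theorem alongFlow_sq_sub (P : DiffPoly I) :
    alongFlow (MvPolynomial.C (idFun I ^ 2)) P - 2 * MvPolynomial.C (idFun I) * totalDeriv P
      = MvPolynomial.mkDerivation (SmoothFun I) (fun k =>
          totalDeriv^[k + 2] (MvPolynomial.C (idFun I ^ 2))
            - 2 * MvPolynomial.C (idFun I) * MvPolynomial.X (k + 1)) P := by
  have h1 : totalDeriv (MvPolynomial.C (idFun I ^ 2))
      = 2 * MvPolynomial.C (idFun I) * MvPolynomial.X 0 := by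
    rw [sq, map_mul, ← totalDerivation_apply, Derivation.leibniz, totalDerivation_apply,
      totalDeriv_u, smul_eq_mul]
    ring
  rw [mkDerivation_sub_mul, alongFlow, h1, totalDeriv]
  ring

/-- The derivation `alongFlow u^2 - 2u ∂_x` maps `u_(j)` to
`(j + 1)! ∑_{a + b = j + 1, a, b ≥ 1} u_(a) u_(b) / (a! b!)`. -/
theorem iterate_totalDeriv_sq_sub (j : ℕ) : totalDeriv^[j + 2] (MvPolynomial.C (idFun I ^ 2))
      - 2 * MvPolynomial.C (idFun I) * MvPolynomial.X (j + 1)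
    = ∑ x ∈ antidiagonal j, (((j + 2).factorial : ℚ)
        * (((x.1 + 1).factorial : ℚ)⁻¹ * ((x.2 + 1).factorial : ℚ)⁻¹)) •
          (MvPolynomial.X x.1 * MvPolynomial.X x.2 : DiffPoly I) := by
  have h := iterate_derivation_sq_succ (S := DiffPoly I) (totalDerivation I)
    (MvPolynomial.C (idFun I)) j
  have hne : ((j + 2).factorial : ℚ) ≠ 0 := by positivity
  have h2 := congrArg (fun P : DiffPoly I => ((j + 2).factorial : ℚ) • P) h
  rw [smul_sub, smul_smul, mul_inv_cancel₀ hne, one_smul, ← mul_smul_comm] at h2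
  simp only [derivation_scaledJet (S := DiffPoly I)] at h2
  rw [smul_smul, mul_inv_cancel₀ hne, one_smul] at h2
  simp only [coe_totalDerivation, iterate_totalDeriv_u] at h2
  rw [sq, map_mul, h2, Finset.smul_sum]
  refine Finset.sum_congr rfl fun x _ => ?_
  rw [smul_mul_smul_comm, smul_smul]

theorem eq_zero_of_alongFlow_sq {P : DiffPoly I} {n : ℕ}
    (hP : P.IsWeightedHomogeneous (fun k : ℕ => k + 1) (n + 1))
    (h : 2 * MvPolynomial.C (idFun I) * totalDeriv P
      - alongFlow (MvPolynomial.C (idFun I ^ 2)) P = 0) : P = 0 := by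
  refine eq_zero_of_mkDerivation_quadratic (κ := fun j x => ((j + 2).factorial : ℚ)
    * (((x.1 + 1).factorial : ℚ)⁻¹ * ((x.2 + 1).factorial : ℚ)⁻¹)) (fun j x => by positivity) ?_ ?_
  · simp only [← iterate_totalDeriv_sq_sub]
    rw [← alongFlow_sq_sub]
    linear_combination -h
  · refine hP.coeff_eq_zero 0 ?_
    rw [map_zero]
    exact (Nat.succ_ne_zero n).symm

theorem IsDeformedForm.unique {f : SmoothFun I} {w w' : FormalForm I} (hw : IsDeformedForm f w)
    (hw' : IsDeformedForm f w') : w = w' := by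
  funext n
  induction n with
  | zero => rw [hw.1, hw'.1]
  | succ n ih =>
    have h := hw.2.2 (n + 1)
    have h' := hw'.2.2 (n + 1)
    rw [formalBracket_burgersForm_succ, ← totalDerivation_apply (w (n + 1)),
      ← flowDerivation_apply _ (w (n + 1))] at h
    rw [formalBracket_burgersForm_succ, ← totalDerivation_apply (w' (n + 1)),
      ← flowDerivation_apply _ (w' (n + 1)), ← ih] at h'
    refine sub_eq_zero.1 (eq_zero_of_alongFlow_sq (n := n) ?_ ?_)
    · intro m hm
      by_contra hne
      exact hm (by rw [MvPolynomial.coeff_sub, (hw.2.1 _).coeff_eq_zero m hne,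
        (hw'.2.1 _).coeff_eq_zero m hne, sub_zero])
    · rw [← totalDerivation_apply, ← flowDerivation_apply, map_sub, map_sub]
      linear_combination h - h'

/-! ### Formal power series in `ε` -/

section PowerSeries

variable {A B : Type*} [CommRing A] [CommRing B]

/-- The sum `∑_n ε^n a_n` of a sequence of formal power series in `ε`. -/
def collapse (a : ℕ → PowerSeries A) : PowerSeries A :=
  PowerSeries.mk fun N => ∑ x ∈ antidiagonal N, PowerSeries.coeff x.2 (a x.1)

theorem coeff_collapse (a : ℕ → PowerSeries A) (N : ℕ) : PowerSeries.coeff N (collapse a)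
    = ∑ x ∈ antidiagonal N, PowerSeries.coeff x.2 (a x.1) := PowerSeries.coeff_mk _ _

theorem collapse_add (a b : ℕ → PowerSeries A) :
    collapse (fun n => a n + b n) = collapse a + collapse b := by
  ext N
  simp only [coeff_collapse, map_add, Finset.sum_add_distrib]

theorem collapse_eq (a : ℕ → PowerSeries A) :
    collapse a = a 0 + PowerSeries.X * collapse (fun n => a (n + 1)) := by
  ext N
  cases N with
  | zero => simp [coeff_collapse]
  | succ N =>
    rw [map_add, PowerSeries.coeff_succ_X_mul, coeff_collapse, coeff_collapse,
      Finset.Nat.sum_antidiagonal_succ]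

theorem collapse_mul_left (b : PowerSeries A) (a : ℕ → PowerSeries A) :
    collapse (fun n => b * a n) = b * collapse a := by
  ext N
  simp only [coeff_collapse, PowerSeries.coeff_mul, Finset.mul_sum]
  have h := sum_antidiagonal_assoc
    (fun i k l => PowerSeries.coeff i b * PowerSeries.coeff l (a k)) N
  rw [← h]
  have h' := sum_antidiagonal_assoc
    (fun k i l => PowerSeries.coeff i b * PowerSeries.coeff l (a k)) N
  rw [← h']
  refine Finset.sum_congr rfl fun x _ => ?_
  rw [← Finset.Nat.sum_antidiagonal_swap]
  simp only [Prod.fst_swap, Prod.snd_swap]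

theorem collapse_zero : collapse (fun _ => (0 : PowerSeries A)) = 0 := by
  ext N
  simp [coeff_collapse]

theorem map_collapse (φ : A →+* B) (a : ℕ → PowerSeries A) :
    PowerSeries.map φ (collapse a) = collapse fun n => PowerSeries.map φ (a n) := by
  ext N
  simp only [coeff_collapse, PowerSeries.coeff_map, map_sum]

/-- A series all of whose terms beyond the first vanish. -/
theorem collapse_of_succ_eq_zero {a : ℕ → PowerSeries A} (h : ∀ n, a (n + 1) = 0) :
    collapse a = a 0 := by
  rw [collapse_eq]
  simp only [h, collapse_zero, mul_zero, add_zero]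

variable [Algebra ℚ A]

/-- The extension of a derivation of `A` to `A[[ε]]` that acts on the coefficients. -/
def seriesDerivation (D : RatDerivation A) : RatDerivation (PowerSeries A) :=
  Derivation.mk'
    { toFun := fun P => PowerSeries.mk fun n => D (PowerSeries.coeff n P)
      map_add' := fun P Q => by ext n; simp
      map_smul' := fun r P => by
        ext n
        rw [PowerSeries.coeff_mk, RingHom.id_apply, PowerSeries.coeff_smul, D.map_smul,
          PowerSeries.coeff_smul, PowerSeries.coeff_mk] }
    (fun P Q => by
      ext n
      simp only [LinearMap.coe_mk, AddHom.coe_mk, smul_eq_mul]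
      rw [mul_comm Q, map_add, PowerSeries.coeff_mk, PowerSeries.coeff_mul, map_sum,
        PowerSeries.coeff_mul, PowerSeries.coeff_mul, ← Finset.sum_add_distrib]
      refine Finset.sum_congr rfl fun x _ => ?_
      rw [Derivation.leibniz, PowerSeries.coeff_mk, PowerSeries.coeff_mk, smul_eq_mul, smul_eq_mul]
      ring)

theorem coeff_seriesDerivation (D : RatDerivation A) (P : PowerSeries A) (n : ℕ) :
    PowerSeries.coeff n (seriesDerivation D P) = D (PowerSeries.coeff n P) :=
  PowerSeries.coeff_mk n fun n => D (PowerSeries.coeff n P)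

theorem coeff_iterate_seriesDerivation (D : RatDerivation A) (P : PowerSeries A) (k n : ℕ) :
    PowerSeries.coeff n ((seriesDerivation D)^[k] P) = D^[k] (PowerSeries.coeff n P) := by
  induction k with
  | zero => rfl
  | succ k ih =>
    rw [Function.iterate_succ_apply', coeff_seriesDerivation, ih, Function.iterate_succ_apply']

theorem seriesDerivation_C (D : RatDerivation A) (a : A) :
    seriesDerivation D (PowerSeries.C a) = PowerSeries.C (D a) := by
  ext n
  rw [coeff_seriesDerivation, PowerSeries.coeff_C, PowerSeries.coeff_C]
  split_ifs <;> simp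

theorem seriesDerivation_X (D : RatDerivation A) : seriesDerivation D PowerSeries.X = 0 := by
  ext n
  rw [coeff_seriesDerivation, PowerSeries.coeff_X]
  split_ifs <;> simp

theorem seriesDerivation_collapse (D : RatDerivation A) (a : ℕ → PowerSeries A) :
    seriesDerivation D (collapse a) = collapse fun n => seriesDerivation D (a n) := by
  ext N
  simp only [coeff_seriesDerivation, coeff_collapse, map_sum]

/-- The formal Taylor expansion `∑_j f_{k+j} (ε w)^j / j!` of the `k`-th derivative of `f` at
`u + ε w`, where `f_j` is the `j`-th derivative at `u`. -/
def formalTaylor (f : ℕ → A) (w : PowerSeries A) (k : ℕ) : PowerSeries A :=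
  collapse fun j => ((j.factorial : ℚ)⁻¹) • (PowerSeries.C (f (k + j)) * w ^ j)

theorem seriesDerivation_formalTaylor {f : ℕ → A} {D : RatDerivation A} {δ : A}
    (hf : ∀ k, D (f k) = f (k + 1) * δ) (w : PowerSeries A) (k : ℕ) :
    seriesDerivation D (formalTaylor f w k) = formalTaylor f w (k + 1)
      * (PowerSeries.C δ + PowerSeries.X * seriesDerivation D w) := by
  have h1 : ∀ j : ℕ, seriesDerivation D ((j.factorial : ℚ)⁻¹ • (PowerSeries.C (f (k + j)) * w ^ j))
      = PowerSeries.C δ * ((j.factorial : ℚ)⁻¹ • (PowerSeries.C (f (k + 1 + j)) * w ^ j))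
        + (j.factorial : ℚ)⁻¹ •
          (PowerSeries.C (f (k + j))
            * ((j : PowerSeries A) * w ^ (j - 1) * seriesDerivation D w)) := by
    intro j
    rw [Derivation.map_smul, Derivation.leibniz, Derivation.leibniz_pow, seriesDerivation_C, hf,
      mul_smul_comm, ← smul_add, show k + 1 + j = k + j + 1 by omega, map_mul]
    congr 1
    simp only [smul_eq_mul, nsmul_eq_mul]
    ring
  rw [formalTaylor, seriesDerivation_collapse]
  simp only [h1]
  rw [collapse_add, collapse_mul_left, collapse_eq (fun j : ℕ => (j.factorial : ℚ)⁻¹ •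
    (PowerSeries.C (f (k + j)) * ((j : PowerSeries A) * w ^ (j - 1) * seriesDerivation D w)))]
  have h2 : ∀ j : ℕ, (((j + 1).factorial : ℚ)⁻¹ • (PowerSeries.C (f (k + (j + 1)))
        * (((j + 1 : ℕ) : PowerSeries A) * w ^ (j + 1 - 1) * seriesDerivation D w)))
      = seriesDerivation D w *
        ((j.factorial : ℚ)⁻¹ • (PowerSeries.C (f (k + 1 + j)) * w ^ j)) := by
    intro j
    have h3 : (((j + 1).factorial : ℚ)⁻¹) * ((j + 1 : ℕ) : ℚ) = (j.factorial : ℚ)⁻¹ := by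
      rw [Nat.factorial_succ]
      push_cast
      have : (j.factorial : ℚ) ≠ 0 := by positivity
      field_simp
    rw [← h3, mul_smul_comm, mul_smul, Nat.cast_smul_eq_nsmul, nsmul_eq_mul, Nat.add_sub_cancel,
      show k + (j + 1) = k + 1 + j by omega]
    congr 1
    ring
  simp only [h2]
  rw [collapse_mul_left]
  simp only [Nat.cast_zero, zero_mul, mul_zero, smul_zero, zero_add, formalTaylor]
  ring

/-- The value of the deformed 1-form at the formal jet of `v`, in `A[[ε]]`. -/
def omegaSeries (D : RatDerivation A) (c : ℕ → PowerSeries A) (v : PowerSeries A) :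
    PowerSeries A :=
  collapse fun n => omega c (scaledJet (seriesDerivation D) v) n 0

/-- Along a formal solution `v` of Burgers' equation `v_t = ∂ (v^2 + ε ∂v)`, the value `Ω` of the
deformed 1-form satisfies the linear equation `Ω_t = 2 v ∂Ω + ε ∂²Ω`. -/
theorem seriesDerivation_omegaSeries {D T : RatDerivation A} (hTD : ∀ a, T (D a) = D (T a))
    {c : ℕ → PowerSeries A} {v : PowerSeries A}
    (hv : seriesDerivation T v = seriesDerivation D (v * v)
      + PowerSeries.X * seriesDerivation D (seriesDerivation D v))
    (hcD : ∀ k, seriesDerivation D (c k) = c (k + 1) * seriesDerivation D v)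
    (hcT : ∀ k, seriesDerivation T (c k) = c (k + 1) * seriesDerivation T v) :
    seriesDerivation T (omegaSeries D c v) = 2 * v * seriesDerivation D (omegaSeries D c v)
      + PowerSeries.X * seriesDerivation D (seriesDerivation D (omegaSeries D c v)) := by
  have hT : ∀ j, seriesDerivation T ((seriesDerivation D)^[j] v)
      = (seriesDerivation D)^[j + 1] (v * v)
        + PowerSeries.X * (seriesDerivation D)^[j + 2] v := by
    intro j
    induction j with
    | zero => exact hv
    | succ j ih =>
      have hcomm : ∀ P, seriesDerivation T (seriesDerivation D P)
          = seriesDerivation D (seriesDerivation T P) := fun P => by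
        ext n
        simp only [coeff_seriesDerivation, hTD]
      rw [Function.iterate_succ_apply', hcomm, ih, map_add, Derivation.leibniz,
        seriesDerivation_X, smul_zero, add_zero, smul_eq_mul,
        ← Function.iterate_succ_apply' (seriesDerivation D),
        ← Function.iterate_succ_apply' (seriesDerivation D)]
  have h0 := flow_omega_zero (S := PowerSeries A) hT hcD hcT 0
  have h1 := fun n => flow_omega_succ (S := PowerSeries A) hT hcD hcT n 0
  set D' := seriesDerivation D with hD'
  set T' := seriesDerivation T with hT'
  set z := omega c (scaledJet D' v) with hz
  set R := flowRemainder D' c v with hR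
  have key : (fun n => T' (z n 0)) = fun n => (2 * v * D' (z n 0) + PowerSeries.X * R n 0)
      + (match n with
        | 0 => 0
        | n + 1 => D' (D' (z n 0)) - R n 0) := by
    funext n
    cases n with
    | zero => rw [h0, add_zero]
    | succ n => rw [h1]; ring
  have hsub : collapse (fun n => D' (D' (z n 0)) - R n 0)
      = collapse (fun n => D' (D' (z n 0))) - collapse (fun n => R n 0) := by
    rw [eq_sub_iff_add_eq, ← collapse_add]
    simp only [sub_add_cancel]
  rw [omegaSeries, ← hD', ← hz, seriesDerivation_collapse, ← hT', key, collapse_add, collapse_add,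
    collapse_mul_left, collapse_mul_left, collapse_eq (fun n => match n with | 0 => 0 | n + 1 => _)]
  simp only [hsub]
  rw [hD']
  simp only [seriesDerivation_collapse]
  ring

theorem map_omega {S S' : Type*} [CommRing S] [Algebra ℚ S] [CommRing S'] [Algebra ℚ S']
    (φ : S →+* S') (c z : ℕ → S) (n k : ℕ) :
    φ (omega c z n k) = omega (fun k => φ (c k)) (fun j => φ (z j)) n k := by
  have hφ : ∀ (r : ℚ) (a : S), φ (r • a) = r • φ a := fun r a => map_rat_smul φ r a
  induction n using Nat.strong_induction_on generalizing k with
  | _ n ih =>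
    cases n with
    | zero => rw [omega_zero, omega_zero]
    | succ n =>
      rw [omega_succ_eq, omega_succ_eq, hφ, map_sum]
      congr 1
      refine Finset.sum_congr rfl fun x hx => ?_
      rw [mem_antidiagonal] at hx
      rw [hφ, map_mul, ih x.1 (by omega)]

theorem omega_succ_eq_zero {S : Type*} [CommRing S] [Algebra ℚ S] {c z : ℕ → S}
    (hz : ∀ j, z (j + 1) = 0) (n k : ℕ) : omega c z (n + 1) k = 0 := by
  rw [omega_succ_eq]
  simp only [hz, mul_zero, smul_zero, Finset.sum_const_zero]

end PowerSeries

/-! ### Polynomials in `u_x` on the hodograph locus -/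

section

open Polynomial

section Hodo

variable {R : Type*} [CommRing R]

theorem coeff_sum_monomial_self {d : R → R} (hd : d 0 = 0) (P : R[X]) (n : ℕ) :
    (P.sum fun e c => monomial e (d c)).coeff n = d (P.coeff n) := by
  rw [Polynomial.sum, finsetSum_coeff]
  simp only [coeff_monomial]
  rw [Finset.sum_ite_eq']
  split_ifs with h
  · rfl
  · rw [notMem_support_iff.1 h, hd]

variable [Algebra ℚ R]

/-- The extension of a derivation `d` of `R` to `R[u_x]` that acts on the coefficients. -/
def polyCoeffDerivation (d : RatDerivation R) : RatDerivation R[X] :=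
  Derivation.mk'
    { toFun := fun P => P.sum fun e c => monomial e (d c)
      map_add' := fun P Q => by
        ext n
        rw [coeff_add, coeff_sum_monomial_self (map_zero d), coeff_sum_monomial_self (map_zero d),
          coeff_sum_monomial_self (map_zero d), coeff_add, map_add]
      map_smul' := fun r P => by
        ext n
        rw [RingHom.id_apply, coeff_smul, coeff_sum_monomial_self (map_zero d),
          coeff_sum_monomial_self (map_zero d), coeff_smul, d.map_smul] }
    (fun P Q => by
      ext n
      simp only [LinearMap.coe_mk, AddHom.coe_mk, smul_eq_mul]
      rw [mul_comm Q, coeff_add, coeff_sum_monomial_self (map_zero d), coeff_mul, map_sum,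
        coeff_mul, coeff_mul, ← Finset.sum_add_distrib]
      refine Finset.sum_congr rfl fun x _ => ?_
      rw [Derivation.leibniz, coeff_sum_monomial_self (map_zero d),
        coeff_sum_monomial_self (map_zero d), smul_eq_mul, smul_eq_mul]
      ring)

theorem coeff_polyCoeffDerivation (d : RatDerivation R) (P : R[X]) (n : ℕ) :
    (polyCoeffDerivation d P).coeff n = d (P.coeff n) :=
  coeff_sum_monomial_self (map_zero d) P n

/-- `∂_x` on `R[u_x]`, where `u_xx = g u_x^3` and `∂_x r = u_x d(r)` for the coefficients
`r ∈ R`. -/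
def hodoDerivation (d : RatDerivation R) (g : R) : RatDerivation R[X] :=
  (X : R[X]) • polyCoeffDerivation d + (C g * X ^ 3 : R[X]) • derivative'.restrictScalars ℚ

theorem hodoDerivation_apply (d : RatDerivation R) (g : R) (P : R[X]) :
    hodoDerivation d g P = X * polyCoeffDerivation d P + C g * X ^ 3 * derivative P := rfl

/-- `∂_t - 2u ∂_x` on `R[u_x]`: it annihilates the coefficients and maps `u_x` to `2 u_x^2`. -/
def hodoTransport (R : Type*) [CommRing R] [Algebra ℚ R] : RatDerivation R[X] :=
  (2 * X ^ 2 : R[X]) • derivative'.restrictScalars ℚ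

theorem hodoTransport_apply (P : R[X]) : hodoTransport R P = 2 * X ^ 2 * derivative P := rfl

theorem hodoDerivation_C (d : RatDerivation R) (g r : R) :
    hodoDerivation d g (C r) = C (d r) * X := by
  rw [hodoDerivation_apply, derivative_C, mul_zero, add_zero, mul_comm]
  congr 1
  ext n
  rw [coeff_polyCoeffDerivation, coeff_C, coeff_C]
  split_ifs <;> simp

theorem polyCoeffDerivation_X (d : RatDerivation R) : polyCoeffDerivation d X = 0 := by
  ext n
  rw [coeff_polyCoeffDerivation, coeff_X]
  split_ifs <;> simp

theorem hodoDerivation_X (d : RatDerivation R) (g : R) :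
    hodoDerivation d g X = C g * X ^ 3 := by
  rw [hodoDerivation_apply, polyCoeffDerivation_X, derivative_X]
  ring

theorem hodoTransport_C (r : R) : hodoTransport R (C r) = 0 := by
  rw [hodoTransport_apply, derivative_C, mul_zero]

theorem hodoTransport_X : hodoTransport R X = 2 * X ^ 2 := by
  rw [hodoTransport_apply, derivative_X, mul_one]

theorem hodoTransport_hodoDerivation (d : RatDerivation R) (g : R) (P : R[X]) :
    hodoTransport R (hodoDerivation d g P)
      = hodoDerivation d g (hodoTransport R P) + 2 * X * hodoDerivation d g P := by
  have hcomm : ∀ Q : R[X],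
      derivative (polyCoeffDerivation d Q) = polyCoeffDerivation d (derivative Q) := fun Q => by
    ext n
    rw [coeff_derivative, coeff_polyCoeffDerivation, coeff_polyCoeffDerivation, coeff_derivative,
      Derivation.leibniz, ← Nat.cast_succ, Derivation.map_natCast, smul_zero, zero_add,
      smul_eq_mul, mul_comm]
  have h2 : polyCoeffDerivation d (2 * X ^ 2 * derivative P)
      = 2 * X ^ 2 * polyCoeffDerivation d (derivative P) := by
    rw [Derivation.leibniz, Derivation.leibniz, Derivation.leibniz_pow, polyCoeffDerivation_X,
      ← Nat.cast_ofNat (n := 2), Derivation.map_natCast]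
    simp
  rw [hodoTransport_apply, hodoTransport_apply, hodoDerivation_apply, hodoDerivation_apply, h2,
    ← hcomm]
  simp only [derivative_add, derivative_mul, derivative_X, derivative_C, derivative_X_pow,
    derivative_ofNat]
  simp only [map_natCast]
  push_cast
  ring

theorem X_pow_dvd_hodoDerivation {d : RatDerivation R} {g : R} {n : ℕ} {P : R[X]}
    (h : X ^ n ∣ P) : X ^ (n + 1) ∣ hodoDerivation d g P := by
  obtain ⟨Q, rfl⟩ := h
  cases n with
  | zero =>
    rw [hodoDerivation_apply]
    exact ⟨polyCoeffDerivation d (X ^ 0 * Q) + C g * X ^ 2 * derivative (X ^ 0 * Q), by ring⟩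
  | succ n =>
    rw [Derivation.leibniz, Derivation.leibniz_pow, hodoDerivation_X, hodoDerivation_apply]
    refine ⟨polyCoeffDerivation d Q + C g * X ^ 2 * derivative Q
      + ((n + 1 : ℕ) : R[X]) * (Q * C g * X), ?_⟩
    simp only [smul_eq_mul, nsmul_eq_mul, Nat.add_sub_cancel]
    ring

theorem eq_zero_of_hodoTransport_eq_zero {P : R[X]} (h : hodoTransport R P = 0)
    (h0 : P.coeff 0 = 0) : P = 0 := by
  rw [hodoTransport_apply] at h
  ext n
  cases n with
  | zero => rw [h0, coeff_zero]
  | succ n =>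
    have h1 := congrArg (fun Q : R[X] => Q.coeff (n + 2)) h
    rw [show (2 * X ^ 2 * derivative P : R[X]) = (C 2 * derivative P) * X ^ 2 by
      rw [map_ofNat]; ring, coeff_mul_X_pow, coeff_C_mul, coeff_derivative, coeff_zero] at h1
    have h2 : (2 * (n + 1 : ℚ)) • P.coeff (n + 1) = 0 := by
      rw [Algebra.smul_def]
      simp only [map_mul, map_add, map_natCast, map_one, map_ofNat]
      linear_combination h1
    rw [coeff_zero]
    exact smul_right_injective R (show (2 * (n + 1 : ℚ)) ≠ 0 by positivity)
      (h2.trans (smul_zero _).symm)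

end Hodo

theorem hodoDx_eq (P : HodoPoly) :
    hodoDx P = hodoDerivation coeffDeriv (MvPolynomial.X 0) P := rfl

theorem transportInv_add (P Q : HodoPoly) :
    transportInv (P + Q) = transportInv P + transportInv Q :=
  sum_add_index P Q _ (fun e => by rw [smul_zero, monomial_zero_right])
    fun e a b => by rw [smul_add, map_add]

theorem transportInv_monomial (e : ℕ) (c : MvPolynomial ℕ ℚ) : transportInv (monomial e c)
    = monomial (e - 1) ((1 / (2 * ((e : ℚ) - 2))) • c) :=
  sum_monomial_index c _ (by rw [smul_zero, monomial_zero_right])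

/-- `transportInv` inverts `L^* = (∂_t - 2u ∂_x) - 2 u_x` on multiples of `u_x^3`, and its values
there are multiples of `u_x^2`. -/
theorem transportInv_spec {P : HodoPoly} (h : X ^ 3 ∣ P) :
    X ^ 2 ∣ transportInv P ∧
      hodoTransport _ (transportInv P) - 2 * X * transportInv P = P := by
  obtain ⟨Q, rfl⟩ := h
  induction Q using Polynomial.induction_on' with
  | add p q hp hq =>
    rw [mul_add, transportInv_add]
    refine ⟨dvd_add hp.1 hq.1, ?_⟩
    rw [map_add]
    linear_combination hp.2 + hq.2
  | monomial n a =>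
    rw [X_pow_mul_monomial, transportInv_monomial]
    have hn : (2 : ℚ) * (((n + 3 : ℕ) : ℚ) - 2) = 2 * (n + 1) := by push_cast; ring
    have hm : ∀ b : MvPolynomial ℕ ℚ, (monomial (n + 3 - 1) b : HodoPoly) = C b * X ^ (n + 2) :=
      fun b => (C_mul_X_pow_eq_monomial).symm
    rw [hn, hm]
    refine ⟨⟨C ((1 / (2 * (n + 1 : ℚ))) • a) * X ^ n, by ring⟩, ?_⟩
    have ha : a = (2 * (n + 1 : ℕ) : MvPolynomial ℕ ℚ) * ((1 / (2 * (n + 1 : ℚ))) • a) := by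
      rw [MvPolynomial.smul_eq_C_mul, ← mul_assoc]
      have : (2 * (n + 1 : ℕ) : MvPolynomial ℕ ℚ) * MvPolynomial.C (1 / (2 * (n + 1 : ℚ))) = 1 := by
        rw [show (2 * (n + 1 : ℕ) : MvPolynomial ℕ ℚ) = MvPolynomial.C (2 * (n + 1 : ℚ)) by
          rw [map_mul, map_ofNat]; simp, ← map_mul, mul_one_div_cancel (by positivity), map_one]
      rw [this, one_mul]
    rw [← C_mul_X_pow_eq_monomial]
    nth_rw 3 [ha]
    rw [hodoTransport_apply, derivative_C_mul, derivative_X_pow, map_mul, map_mul]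
    simp only [map_natCast, map_ofNat]
    push_cast
    ring

/-! ### The quasi-Miura series as a formal solution of Burgers' equation -/

theorem hodoCorrection_succ (n : ℕ) : hodoCorrection (n + 1) = transportInv (hodoDx
    ((∑ i : Fin n, hodoCorrection (i + 1) * hodoCorrection (n - i))
      + if n = 0 then X else hodoDx (hodoCorrection n))) := by
  rw [hodoCorrection]

theorem X_pow_dvd_hodoCorrection_source {n : ℕ}
    (h : ∀ m < n, X ^ 2 ∣ hodoCorrection (m + 1)) : X ^ 3 ∣ hodoDx
    ((∑ i : Fin n, hodoCorrection (i + 1) * hodoCorrection (n - i))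
      + if n = 0 then X else hodoDx (hodoCorrection n)) := by
  cases n with
  | zero =>
    rw [Fin.sum_univ_zero, if_pos rfl, zero_add, hodoDx_eq, hodoDerivation_X]
    exact dvd_mul_left _ _
  | succ n =>
    rw [if_neg (Nat.succ_ne_zero n), hodoDx_eq, hodoDx_eq]
    refine X_pow_dvd_hodoDerivation (dvd_add (Finset.dvd_sum fun i _ => ?_) ?_)
    · exact (h i i.2).mul_right _
    · exact (pow_dvd_pow X (by norm_num)).trans
        (X_pow_dvd_hodoDerivation (h n (Nat.lt_succ_self n)))

theorem X_sq_dvd_hodoCorrection (n : ℕ) : X ^ 2 ∣ hodoCorrection (n + 1) := by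
  induction n using Nat.strong_induction_on with
  | _ n ih =>
    rw [hodoCorrection_succ]
    exact (transportInv_spec (X_pow_dvd_hodoCorrection_source ih)).1

theorem hodoCorrection_transport (n : ℕ) :
    hodoTransport _ (hodoCorrection (n + 1)) - 2 * X * hodoCorrection (n + 1) = hodoDx
      ((∑ i : Fin n, hodoCorrection (i + 1) * hodoCorrection (n - i))
        + if n = 0 then X else hodoDx (hodoCorrection n)) := by
  have h := (transportInv_spec (X_pow_dvd_hodoCorrection_source
    (fun m (_ : m < n) => X_sq_dvd_hodoCorrection m))).2
  rwa [← hodoCorrection_succ] at h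

/-- The inclusion of `ℚ[f'', f''', …][u_x]` into `ℚ[u, f, f', f'', …][u_x]`. In the larger ring the
coefficient variable `X 0` stands for `u` and `X (k + 1)` for `f^(k)(u)`. -/
def hodoInclusion : HodoPoly →+* HodoPoly :=
  mapRingHom (MvPolynomial.rename (· + 3) : MvPolynomial ℕ ℚ →ₐ[ℚ] MvPolynomial ℕ ℚ).toRingHom

/-- `∂/∂u` on `ℚ[u, f, f', …]`. -/
def fullCoeffDeriv : RatDerivation (MvPolynomial ℕ ℚ) :=
  MvPolynomial.mkDerivation ℚ fun k => if k = 0 then 1 else MvPolynomial.X (k + 1)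

/-- `∂_x` on `ℚ[u, f, f', …][u_x]`. -/
def fullDx : RatDerivation HodoPoly := hodoDerivation fullCoeffDeriv (MvPolynomial.X 3)

/-- The function `u` in `ℚ[u, f, f', …][u_x]`. -/
def uVar : HodoPoly := C (MvPolynomial.X 0)

/-- The function `f^(k)(u)` in `ℚ[u, f, f', …][u_x]`. -/
def fVar (k : ℕ) : HodoPoly := C (MvPolynomial.X (k + 1))

/-- `∂_t` on `ℚ[u, f, f', …][u_x]`. -/
def fullDt : RatDerivation HodoPoly := hodoTransport _ + (2 * uVar : HodoPoly) • fullDx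

theorem fullDt_apply (P : HodoPoly) :
    fullDt P = hodoTransport _ P + 2 * uVar * fullDx P := rfl

theorem fullDx_uVar : fullDx uVar = X := by
  rw [fullDx, uVar, hodoDerivation_C, fullCoeffDeriv, MvPolynomial.mkDerivation_X, if_pos rfl,
    map_one, one_mul]

theorem fullDx_fVar (k : ℕ) : fullDx (fVar k) = fVar (k + 1) * X := by
  rw [fullDx, fVar, hodoDerivation_C, fullCoeffDeriv, MvPolynomial.mkDerivation_X,
    if_neg (Nat.succ_ne_zero k), fVar]

theorem fullDx_X : fullDx X = fVar 2 * X ^ 3 := hodoDerivation_X _ _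

theorem fullDt_uVar : fullDt uVar = 2 * uVar * X := by
  rw [fullDt_apply, fullDx_uVar, uVar, hodoTransport_C, zero_add]

theorem fullDt_fVar (k : ℕ) : fullDt (fVar k) = fVar (k + 1) * (2 * uVar * X) := by
  rw [fullDt_apply, fullDx_fVar, fVar, hodoTransport_C, zero_add]
  ring

theorem fullDt_fullDx (P : HodoPoly) : fullDt (fullDx P) = fullDx (fullDt P) := by
  have h2 : fullDx (2 * uVar) = 2 * X := by
    rw [two_mul, map_add, fullDx_uVar, two_mul]
  rw [fullDt_apply, fullDt_apply, map_add, Derivation.leibniz, h2, fullDx,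
    hodoTransport_hodoDerivation, smul_eq_mul, smul_eq_mul]
  ring

theorem hodoInclusion_hodoDx (P : HodoPoly) :
    hodoInclusion (hodoDx P) = fullDx (hodoInclusion P) := by
  have hC : ∀ a : MvPolynomial ℕ ℚ,
      MvPolynomial.rename (· + 3) (coeffDeriv a)
        = fullCoeffDeriv (MvPolynomial.rename (· + 3) a) := by
    intro a
    induction a using MvPolynomial.induction_on with
    | C r => rw [coeffDeriv, fullCoeffDeriv, MvPolynomial.derivation_C, MvPolynomial.rename_C,
        MvPolynomial.derivation_C, map_zero]
    | add p q hp hq => simp only [map_add, hp, hq]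
    | mul_X p n hp =>
      have h1 : coeffDeriv (MvPolynomial.X n) = MvPolynomial.X (n + 1) :=
        MvPolynomial.mkDerivation_X _ _ _
      have h2 : fullCoeffDeriv (MvPolynomial.X (n + 3)) = MvPolynomial.X (n + 1 + 3) := by
        rw [fullCoeffDeriv, MvPolynomial.mkDerivation_X, if_neg (Nat.succ_ne_zero _)]
      rw [Derivation.leibniz, map_mul, Derivation.leibniz, map_add, smul_eq_mul, smul_eq_mul,
        smul_eq_mul, smul_eq_mul, map_mul, map_mul, hp, h1, MvPolynomial.rename_X,
        MvPolynomial.rename_X, h2]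
  have hX : hodoInclusion X = X := map_X _
  have hCC : ∀ a, hodoInclusion (C a) = C (MvPolynomial.rename (· + 3) a) := fun a => map_C _
  rw [hodoDx_eq]
  induction P using Polynomial.induction_on' with
  | add p q hp hq => simp only [map_add, hp, hq]
  | monomial n a =>
    have hm : hodoInclusion (C a * X ^ n) = C (MvPolynomial.rename (· + 3) a) * X ^ n := by
      rw [map_mul, map_pow, hX, hCC]
    rw [← C_mul_X_pow_eq_monomial, hm, fullDx]
    simp only [Derivation.leibniz, Derivation.leibniz_pow, hodoDerivation_C, hodoDerivation_X,
      smul_eq_mul, nsmul_eq_mul, map_add, map_mul, map_pow, hX, hCC, hC, map_natCast,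
      MvPolynomial.rename_X]

theorem hodoInclusion_hodoTransport (P : HodoPoly) :
    hodoInclusion (hodoTransport _ P) = hodoTransport _ (hodoInclusion P) := by
  rw [hodoTransport_apply, hodoTransport_apply, map_mul, map_mul, map_pow, map_ofNat]
  change _ * map _ X ^ 2 * map _ (derivative P) = _
  rw [map_X, ← derivative_map]
  rfl

/-- The coefficients of the quasi-Miura series `v`, in `ℚ[u, f, f', …][u_x]`. -/
def quasiMiuraCoeff : ℕ → HodoPoly
  | 0 => uVar
  | n + 1 => hodoInclusion (hodoCorrection (n + 1))

theorem fullDt_quasiMiuraCoeff (n : ℕ) : fullDt (quasiMiuraCoeff n) = fullDx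
    ((∑ x ∈ antidiagonal n, quasiMiuraCoeff x.1 * quasiMiuraCoeff x.2)
      + if n = 0 then 0 else fullDx (quasiMiuraCoeff (n - 1))) := by
  cases n with
  | zero =>
    rw [Finset.Nat.antidiagonal_zero, Finset.sum_singleton, if_pos rfl, add_zero,
      quasiMiuraCoeff, Derivation.leibniz, fullDx_uVar, fullDt_uVar, smul_eq_mul]
    ring
  | succ n =>
    have h := congrArg hodoInclusion (hodoCorrection_transport n)
    have hX : hodoInclusion X = X := map_X _
    rw [map_sub, map_mul, map_mul, map_ofNat, hX, hodoInclusion_hodoTransport,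
      hodoInclusion_hodoDx, map_add, map_sum] at h
    have hif : hodoInclusion (if n = 0 then X else hodoDx (hodoCorrection n))
        = fullDx (quasiMiuraCoeff n) := by
      cases n with
      | zero => rw [if_pos rfl, hX, quasiMiuraCoeff, fullDx_uVar]
      | succ n => rw [if_neg (Nat.succ_ne_zero n), hodoInclusion_hodoDx, quasiMiuraCoeff]
    have hsum : ∑ x ∈ antidiagonal (n + 1), quasiMiuraCoeff x.1 * quasiMiuraCoeff x.2
        = ∑ i : Fin n, hodoInclusion (hodoCorrection (i + 1) * hodoCorrection (n - i))
          + 2 * uVar * quasiMiuraCoeff (n + 1) := by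
      have h3 : ∑ i : Fin n, hodoInclusion (hodoCorrection (i + 1) * hodoCorrection (n - i))
          = ∑ i ∈ Finset.range n, quasiMiuraCoeff (i + 1) * quasiMiuraCoeff (n - i) := by
        rw [← Fin.sum_univ_eq_sum_range
          (fun i => quasiMiuraCoeff (i + 1) * quasiMiuraCoeff (n - i))]
        refine Finset.sum_congr rfl fun i _ => ?_
        rw [map_mul, quasiMiuraCoeff]
        congr 1
        rw [show n - (i : ℕ) = n - i - 1 + 1 by omega, quasiMiuraCoeff]
      rw [h3, Finset.Nat.sum_antidiagonal_eq_sum_range_succ_mk, Finset.sum_range_succ,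
        Finset.sum_range_succ', Nat.sub_self, Nat.sub_zero]
      simp only [Nat.succ_sub_succ_eq_sub]
      rw [show quasiMiuraCoeff 0 = uVar from rfl]
      ring
    rw [if_neg (Nat.succ_ne_zero n), Nat.add_sub_cancel, ← hif, hsum]
    have h4 : fullDx (2 * uVar * quasiMiuraCoeff (n + 1))
        = 2 * X * quasiMiuraCoeff (n + 1) + 2 * uVar * fullDx (quasiMiuraCoeff (n + 1)) := by
      rw [Derivation.leibniz, two_mul, map_add, fullDx_uVar, smul_eq_mul, smul_eq_mul]
      ring
    rw [fullDt_apply, add_right_comm, map_add, h4, ← h, quasiMiuraCoeff]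
    ring

/-- The formal series `v`, over `ℚ[u, f, f', …][u_x]`. -/
def formalMiura : PowerSeries HodoPoly := PowerSeries.mk quasiMiuraCoeff

theorem seriesDerivation_formalMiura : seriesDerivation fullDt formalMiura
    = seriesDerivation fullDx (formalMiura * formalMiura)
      + PowerSeries.X * seriesDerivation fullDx (seriesDerivation fullDx formalMiura) := by
  ext1 n
  rw [map_add, coeff_seriesDerivation, coeff_seriesDerivation, PowerSeries.coeff_mul, formalMiura]
  simp only [PowerSeries.coeff_mk]
  rw [fullDt_quasiMiuraCoeff, map_add]
  congr 1
  cases n with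
  | zero => simp
  | succ n => simp [PowerSeries.coeff_succ_X_mul, coeff_seriesDerivation]

/-! ### The deformed hodograph equation, formally -/

/-- The series `(v - u) / (ε u_x)`. -/
def reducedMiura : PowerSeries HodoPoly := PowerSeries.mk fun n => divX (quasiMiuraCoeff (n + 1))

theorem quasiMiuraCoeff_succ (n : ℕ) :
    quasiMiuraCoeff (n + 1) = X * divX (quasiMiuraCoeff (n + 1)) := by
  have h : (quasiMiuraCoeff (n + 1)).coeff 0 = 0 := by
    obtain ⟨Q, hQ⟩ := X_sq_dvd_hodoCorrection n
    have hX : hodoInclusion X = X := map_X _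
    rw [quasiMiuraCoeff, hQ, map_mul, map_pow, hX, pow_two, mul_assoc, coeff_X_mul_zero]
  conv_lhs => rw [← X_mul_divX_add (quasiMiuraCoeff (n + 1)), h, map_zero, add_zero]

theorem formalMiura_eq : formalMiura = PowerSeries.C uVar
    + PowerSeries.X * (PowerSeries.C X * reducedMiura) := by
  ext1 n
  cases n with
  | zero => simp [formalMiura, quasiMiuraCoeff]
  | succ n =>
    rw [map_add, PowerSeries.coeff_succ_X_mul, PowerSeries.coeff_C_mul, formalMiura, reducedMiura,
      PowerSeries.coeff_mk, PowerSeries.coeff_mk, ← quasiMiuraCoeff_succ, PowerSeries.coeff_C,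
      if_neg (Nat.succ_ne_zero n), zero_add]

/-- The Taylor expansion of `f^(k)(v)`. -/
def formalCoeffSeq (k : ℕ) : PowerSeries HodoPoly :=
  formalTaylor fVar (PowerSeries.C X * reducedMiura) k

/-- The series `ω_f(v, v_x, …)`. -/
def formalOmega : PowerSeries HodoPoly := omegaSeries fullDx formalCoeffSeq formalMiura

theorem fullDx_formalCoeffSeq (k : ℕ) : seriesDerivation fullDx (formalCoeffSeq k)
    = formalCoeffSeq (k + 1) * seriesDerivation fullDx formalMiura := by
  rw [formalCoeffSeq, seriesDerivation_formalTaylor fullDx_fVar, formalMiura_eq, map_add,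
    seriesDerivation_C, fullDx_uVar, Derivation.leibniz _ PowerSeries.X, seriesDerivation_X,
    smul_zero, add_zero, smul_eq_mul, formalCoeffSeq]

theorem fullDt_formalCoeffSeq (k : ℕ) : seriesDerivation fullDt (formalCoeffSeq k)
    = formalCoeffSeq (k + 1) * seriesDerivation fullDt formalMiura := by
  rw [formalCoeffSeq, seriesDerivation_formalTaylor fullDt_fVar, formalMiura_eq, map_add,
    seriesDerivation_C, fullDt_uVar, Derivation.leibniz _ PowerSeries.X, seriesDerivation_X,
    smul_zero, add_zero, smul_eq_mul, formalCoeffSeq]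

theorem seriesDerivation_fullDt (P : PowerSeries HodoPoly) : seriesDerivation fullDt P
    = seriesDerivation (hodoTransport _) P
      + 2 * PowerSeries.C uVar * seriesDerivation fullDx P := by
  ext1 n
  rw [← map_ofNat (PowerSeries.C (R := HodoPoly)) 2, ← map_mul, map_add, PowerSeries.coeff_C_mul]
  simp only [coeff_seriesDerivation, fullDt_apply]

/-- The left-hand side of the deformed hodograph equation: since `x = -f(u) - 2ut` and
`2t = -f'(u) - 1/u_x` on the hodograph locus, `x + 2vt + ω_f(v)` equals
`ω_f(v) - f(u) - f'(u) (v - u) - (v - u)/u_x`. -/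
def formalHodograph : PowerSeries HodoPoly := formalOmega - PowerSeries.C (fVar 0)
  - PowerSeries.C (fVar 1) * (PowerSeries.X * (PowerSeries.C X * reducedMiura))
  - PowerSeries.X * reducedMiura

theorem hodoTransport_formalHodograph :
    seriesDerivation (hodoTransport _) formalHodograph
      = 2 * (PowerSeries.X * (PowerSeries.C X * reducedMiura))
          * seriesDerivation fullDx formalHodograph
        + PowerSeries.X * seriesDerivation fullDx (seriesDerivation fullDx formalHodograph) := by
  have hV := seriesDerivation_formalMiura
  have hΩ := seriesDerivation_omegaSeries fullDt_fullDx hV fullDx_formalCoeffSeq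
    fullDt_formalCoeffSeq
  rw [← formalOmega, seriesDerivation_fullDt] at hΩ
  rw [seriesDerivation_fullDt] at hV
  rw [formalHodograph]
  rw [formalMiura_eq] at hV hΩ
  generalize formalOmega = Ω at hΩ ⊢
  generalize reducedMiura = r at hV hΩ ⊢
  have hx : seriesDerivation fullDx (PowerSeries.C X)
      = PowerSeries.C (fVar 2) * PowerSeries.C X ^ 3 := by
    rw [seriesDerivation_C, fullDx_X, map_mul, map_pow]
  have hf : ∀ k, seriesDerivation fullDx (PowerSeries.C (fVar k))
      = PowerSeries.C (fVar (k + 1)) * PowerSeries.C X := fun k => by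
    rw [seriesDerivation_C, fullDx_fVar, map_mul]
  have hu : seriesDerivation fullDx (PowerSeries.C uVar) = PowerSeries.C X := by
    rw [seriesDerivation_C, fullDx_uVar]
  have hLx : seriesDerivation (hodoTransport (MvPolynomial ℕ ℚ)) (PowerSeries.C X)
      = 2 * PowerSeries.C X ^ 2 := by
    rw [seriesDerivation_C, hodoTransport_X, map_mul, map_pow, map_ofNat]
  have hLf : ∀ k, seriesDerivation (hodoTransport _) (PowerSeries.C (fVar k)) = 0 := fun k => by
    rw [seriesDerivation_C, fVar, hodoTransport_C, map_zero]
  have hLu : seriesDerivation (hodoTransport _) (PowerSeries.C uVar) = 0 := by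
    rw [seriesDerivation_C, uVar, hodoTransport_C, map_zero]
  have hLe : seriesDerivation (hodoTransport (MvPolynomial ℕ ℚ)) PowerSeries.X = 0 :=
    seriesDerivation_X _
  have hDe : seriesDerivation fullDx PowerSeries.X = 0 := seriesDerivation_X _
  have hX0 : (PowerSeries.C (X : HodoPoly)) ≠ 0 := by
    rw [Ne, ← map_zero (PowerSeries.C (R := HodoPoly))]
    exact fun h => X_ne_zero (PowerSeries.C_injective h)
  -- both sides are compared after multiplication by `u_x`, which turns `(v - u)/u_x` into `v - u`
  apply mul_left_cancel₀ hX0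
  generalize PowerSeries.C (X : HodoPoly) = x at *
  generalize (PowerSeries.X : PowerSeries HodoPoly) = e at *
  generalize PowerSeries.C uVar = u at *
  simp only [map_add, map_sub, Derivation.leibniz, Derivation.leibniz_pow, hx, hf, hu, hLx, hLf,
    hLu, hLe, hDe, smul_eq_mul, nsmul_eq_mul, mul_zero, add_zero, zero_add, Nat.reduceSub]
    at hV hΩ ⊢
  push_cast at hV hΩ ⊢
  linear_combination x * hΩ - (x * PowerSeries.C (fVar 1) + 1) * hV

theorem coeff_zero_fullDx (P : HodoPoly) : (fullDx P).coeff 0 = 0 := by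
  have h : X ∣ fullDx P := by
    simpa [fullDx] using X_pow_dvd_hodoDerivation (d := fullCoeffDeriv) (g := MvPolynomial.X 3)
      (n := 0) (P := P) (by simp)
  obtain ⟨Q, hQ⟩ := h
  rw [hQ, coeff_X_mul_zero]

/-- At `u_x = 0` the series `ω_f(v, v_x, …)` reduces to `f(u)`, because `v - u` and all the
derivatives of `v` are multiples of `u_x`. -/
theorem map_constantCoeff_formalOmega :
    PowerSeries.map (constantCoeff (R := MvPolynomial ℕ ℚ)) formalOmega
      = PowerSeries.C (MvPolynomial.X 1) := by
  have hc : PowerSeries.map (constantCoeff (R := MvPolynomial ℕ ℚ)) (formalCoeffSeq 0)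
      = PowerSeries.C (MvPolynomial.X 1) := by
    have hsmul : ∀ (r : ℚ) (P : PowerSeries HodoPoly),
        PowerSeries.map (constantCoeff (R := MvPolynomial ℕ ℚ)) (r • P)
          = r • PowerSeries.map (constantCoeff (R := MvPolynomial ℕ ℚ)) P :=
      fun r P => map_rat_smul _ r P
    have hX : PowerSeries.map (constantCoeff (R := MvPolynomial ℕ ℚ)) (PowerSeries.C X) = 0 := by
      rw [PowerSeries.map_C]
      simp
    rw [formalCoeffSeq, formalTaylor, map_collapse, collapse_of_succ_eq_zero]
    · rw [hsmul]
      simp [fVar]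
    · intro n
      rw [hsmul, map_mul, map_pow, map_mul, hX, zero_mul, zero_pow (Nat.succ_ne_zero n), mul_zero,
        smul_zero]
  rw [formalOmega, omegaSeries, map_collapse, collapse_of_succ_eq_zero]
  · rw [omega_zero, hc]
  · intro n
    rw [map_omega]
    refine omega_succ_eq_zero (fun j => ?_) n 0
    rw [scaledJet, map_rat_smul, Function.iterate_succ_apply']
    have h : PowerSeries.map (constantCoeff (R := MvPolynomial ℕ ℚ))
        (seriesDerivation fullDx ((seriesDerivation fullDx)^[j] formalMiura)) = 0 := by
      ext1 m
      rw [PowerSeries.coeff_map, coeff_seriesDerivation, constantCoeff_apply, coeff_zero_fullDx,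
        map_zero]
    rw [h, smul_zero]

theorem coeff_zero_reducedMiura (n : ℕ) : (PowerSeries.coeff n reducedMiura).coeff 0 = 0 := by
  obtain ⟨Q, hQ⟩ := X_sq_dvd_hodoCorrection n
  have hX : hodoInclusion X = X := map_X _
  rw [reducedMiura, PowerSeries.coeff_mk, coeff_divX, quasiMiuraCoeff, hQ, map_mul, map_pow, hX,
    zero_add, coeff_X_pow_mul']
  simp

theorem formalHodograph_eq_zero : formalHodograph = 0 := by
  have h0 : ∀ n, (PowerSeries.coeff n formalHodograph).coeff 0 = 0 := by
    intro n
    have h1 := congrArg (PowerSeries.coeff n) map_constantCoeff_formalOmega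
    rw [PowerSeries.coeff_map, constantCoeff_apply] at h1
    have h2 : ∀ P : PowerSeries HodoPoly, (∀ m, (PowerSeries.coeff m P).coeff 0 = 0) →
        (PowerSeries.coeff n (PowerSeries.X * P)).coeff 0 = 0 := by
      intro P hP
      cases n with
      | zero => simp
      | succ n => rw [PowerSeries.coeff_succ_X_mul, hP]
    rw [formalHodograph, map_sub, map_sub, map_sub, coeff_sub, coeff_sub, coeff_sub, h1,
      h2 _ coeff_zero_reducedMiura, PowerSeries.coeff_C_mul, mul_coeff_zero,
      h2 _ (fun m => by rw [PowerSeries.coeff_C_mul, coeff_X_mul_zero]), PowerSeries.coeff_C,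
      PowerSeries.coeff_C]
    split_ifs <;> simp [fVar]
  ext1 n
  rw [map_zero]
  induction n using Nat.strong_induction_on with
  | _ n ih =>
    refine eq_zero_of_hodoTransport_eq_zero ?_ (h0 n)
    have h := congrArg (PowerSeries.coeff n) hodoTransport_formalHodograph
    rw [coeff_seriesDerivation] at h
    rw [h]
    cases n with
    | zero => simp
    | succ n =>
      rw [show 2 * (PowerSeries.X * (PowerSeries.C X * reducedMiura))
          * seriesDerivation fullDx formalHodograph
          = PowerSeries.X * (2 * (PowerSeries.C X * reducedMiura)
            * seriesDerivation fullDx formalHodograph) by ring, map_add,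
        PowerSeries.coeff_succ_X_mul, PowerSeries.coeff_succ_X_mul, coeff_seriesDerivation,
        coeff_seriesDerivation, ih n (Nat.lt_succ_self n), map_zero, map_zero, add_zero,
        PowerSeries.coeff_mul]
      refine Finset.sum_eq_zero fun x hx => ?_
      rw [mem_antidiagonal] at hx
      rw [coeff_seriesDerivation, ih x.2 (by omega), map_zero, mul_zero]

/-! ### The first terms of the quasi-Miura series -/

/-- A multiple `w` of `u_x^2` is determined by `L^* w`. -/
theorem transportInv_eq {w P : HodoPoly} (hw : X ^ 2 ∣ w) (hP : X ^ 3 ∣ P)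
    (h : hodoTransport _ w - 2 * X * w = P) : transportInv P = w := by
  obtain ⟨h2, h3⟩ := transportInv_spec hP
  obtain ⟨Q, hQ⟩ := dvd_sub h2 hw
  have h4 : hodoTransport _ (X * Q) = 0 := by
    have h5 : hodoTransport _ (transportInv P - w) = 2 * X * (transportInv P - w) := by
      rw [map_sub]
      linear_combination h3 - h
    rw [hQ, pow_two, mul_assoc, Derivation.leibniz, hodoTransport_X, smul_eq_mul, smul_eq_mul] at h5
    have hX : (X : HodoPoly) ≠ 0 := X_ne_zero
    apply mul_left_cancel₀ hX
    linear_combination h5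
  have h6 := eq_zero_of_hodoTransport_eq_zero h4 (coeff_X_mul_zero _)
  rw [← sub_eq_zero, hQ, pow_two, mul_assoc, h6, mul_zero]

theorem hodoCorrection_succ_eq {n : ℕ} {w : HodoPoly} (hw : X ^ 2 ∣ w)
    (h : hodoTransport _ w - 2 * X * w = hodoDx
      ((∑ i : Fin n, hodoCorrection (i + 1) * hodoCorrection (n - i))
        + if n = 0 then X else hodoDx (hodoCorrection n))) : hodoCorrection (n + 1) = w := by
  rw [hodoCorrection_succ]
  exact transportInv_eq hw
    (X_pow_dvd_hodoCorrection_source fun m _ => X_sq_dvd_hodoCorrection m) h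

/-- If the source of the transport equation is `∂_x (∂_t - 2u ∂_x) Φ`, then `v^n = ∂_x Φ`. -/
theorem hodoCorrection_succ_eq_hodoDx {n : ℕ} {Φ : HodoPoly} (hΦ : X ∣ Φ)
    (h : hodoTransport _ Φ = (∑ i : Fin n, hodoCorrection (i + 1) * hodoCorrection (n - i))
        + if n = 0 then X else hodoDx (hodoCorrection n)) :
    hodoCorrection (n + 1) = hodoDx Φ := by
  refine hodoCorrection_succ_eq (X_pow_dvd_hodoDerivation (n := 1) (by rwa [pow_one])) ?_
  rw [← h, hodoDx_eq, hodoDx_eq, hodoTransport_hodoDerivation]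
  ring

theorem hodoDx_C_X (k : ℕ) :
    hodoDx (C (MvPolynomial.X k)) = C (MvPolynomial.X (k + 1)) * X := by
  rw [hodoDx_eq, hodoDerivation_C, coeffDeriv, MvPolynomial.mkDerivation_X]

theorem hodoCorrection_one :
    hodoCorrection 1 = (1 / 2 : ℚ) • (C (MvPolynomial.X 0) * X ^ 2) := by
  refine hodoCorrection_succ_eq (n := 0) ⟨(1 / 2 : ℚ) • C (MvPolynomial.X 0), by
    rw [mul_smul_comm, mul_comm]⟩ ?_
  rw [Fin.sum_univ_zero, if_pos rfl, zero_add, hodoDx_eq, hodoDerivation_X, Derivation.map_smul,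
    Derivation.leibniz, Derivation.leibniz_pow, hodoTransport_C, hodoTransport_X]
  simp only [smul_eq_mul, nsmul_eq_mul, mul_zero, add_zero]
  push_cast
  algebra

/-- The second term of the quasi-Miura series is the `x`-derivative of this polynomial. -/
def secondPotential : HodoPoly := (1 / 8 : ℚ) • (C (MvPolynomial.X 1) * X ^ 2)
  + (5 / 24 : ℚ) • (C (MvPolynomial.X 0) ^ 2 * X ^ 3)

/-- The third term of the quasi-Miura series is the `x`-derivative of this polynomial. -/
def thirdPotential : HodoPoly := (1 / 48 : ℚ) • (C (MvPolynomial.X 3) * X ^ 3)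
  + (7 / 48 : ℚ) • (C (MvPolynomial.X 0) * C (MvPolynomial.X 2) * X ^ 4)
  + (1 / 12 : ℚ) • (C (MvPolynomial.X 1) ^ 2 * X ^ 4)
  + (25 / 48 : ℚ) • (C (MvPolynomial.X 0) ^ 2 * C (MvPolynomial.X 1) * X ^ 5)
  + (5 / 16 : ℚ) • (C (MvPolynomial.X 0) ^ 4 * X ^ 6)

theorem hodoDx_add (P Q : HodoPoly) : hodoDx (P + Q) = hodoDx P + hodoDx Q :=
  map_add (hodoDerivation coeffDeriv (MvPolynomial.X 0)) P Q

theorem hodoDx_smul (r : ℚ) (P : HodoPoly) : hodoDx (r • P) = r • hodoDx P :=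
  (hodoDerivation coeffDeriv (MvPolynomial.X 0)).map_smul r P

theorem hodoDx_mul (P Q : HodoPoly) : hodoDx (P * Q) = P * hodoDx Q + Q * hodoDx P :=
  (hodoDerivation coeffDeriv (MvPolynomial.X 0)).leibniz P Q

theorem hodoDx_pow (P : HodoPoly) (n : ℕ) :
    hodoDx (P ^ n) = (n : HodoPoly) * (P ^ (n - 1) * hodoDx P) := by
  rw [hodoDx_eq, Derivation.leibniz_pow, nsmul_eq_mul, smul_eq_mul]
  rfl

theorem hodoDx_X : hodoDx X = C (MvPolynomial.X 0) * X ^ 3 := hodoDerivation_X _ _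

theorem hodoCorrection_two : hodoCorrection 2 = hodoDx secondPotential := by
  refine hodoCorrection_succ_eq_hodoDx (n := 1) (dvd_add ?_ ?_) ?_
  · exact (Dvd.intro ((1 / 8 : ℚ) • (C (MvPolynomial.X 1) * X)) (by algebra))
  · exact (Dvd.intro ((5 / 24 : ℚ) • (C (MvPolynomial.X 0) ^ 2 * X ^ 2)) (by algebra))
  · rw [Fin.sum_univ_one, if_neg one_ne_zero]
    simp only [Fin.val_zero, zero_add, Nat.sub_zero, hodoCorrection_one, secondPotential]
    simp only [map_add, Derivation.map_smul, Derivation.leibniz, Derivation.leibniz_pow,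
      hodoTransport_C, hodoTransport_X, hodoDx_smul, hodoDx_mul, hodoDx_pow, hodoDx_C_X, hodoDx_X,
      smul_eq_mul, nsmul_eq_mul]
    push_cast
    algebra

theorem hodoCorrection_three : hodoCorrection 3 = hodoDx thirdPotential := by
  refine hodoCorrection_succ_eq_hodoDx (n := 2)
    (dvd_add (dvd_add (dvd_add (dvd_add ?_ ?_) ?_) ?_) ?_) ?_
  · exact (Dvd.intro ((1 / 48 : ℚ) • (C (MvPolynomial.X 3) * X ^ 2)) (by algebra))
  · exact (Dvd.intro ((7 / 48 : ℚ) • (C (MvPolynomial.X 0) * C (MvPolynomial.X 2) * X ^ 3))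
      (by algebra))
  · exact (Dvd.intro ((1 / 12 : ℚ) • (C (MvPolynomial.X 1) ^ 2 * X ^ 3)) (by algebra))
  · exact (Dvd.intro ((25 / 48 : ℚ) • (C (MvPolynomial.X 0) ^ 2 * C (MvPolynomial.X 1) * X ^ 4))
      (by algebra))
  · exact (Dvd.intro ((5 / 16 : ℚ) • (C (MvPolynomial.X 0) ^ 4 * X ^ 5)) (by algebra))
  · rw [Fin.sum_univ_two, if_neg two_ne_zero]
    simp only [Fin.val_zero, Fin.val_one, zero_add, Nat.sub_zero, Nat.reduceSub, Nat.reduceAdd,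
      hodoCorrection_one, hodoCorrection_two, secondPotential, thirdPotential]
    simp only [map_add, Derivation.map_smul, Derivation.leibniz, Derivation.leibniz_pow,
      hodoTransport_C, hodoTransport_X, hodoDx_add, hodoDx_smul, hodoDx_mul, hodoDx_pow, hodoDx_C_X,
      hodoDx_X, smul_eq_mul, nsmul_eq_mul]
    push_cast
    simp only [pow_one, mul_zero, add_zero]
    have hnat : ∀ k : ℕ, hodoDx (k : HodoPoly) = 0 := fun k =>
      Derivation.map_natCast (hodoDerivation coeffDeriv (MvPolynomial.X 0)) k
    have h2 : hodoDx (2 : HodoPoly) = 0 := by exact_mod_cast hnat 2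
    have h3 : hodoDx (3 : HodoPoly) = 0 := by exact_mod_cast hnat 3
    simp only [h2, h3]
    algebra

end

/-! ### Values of differential polynomials at formal jets -/

/-- The substitution in the Taylor expansion, written as a sum over powers of `ε`. -/
theorem taylorComp_eq (c : SmoothFun I) (v : ℝ) (W : PowerSeries ℝ) :
    taylorComp c (PowerSeries.C v + PowerSeries.X * W)
      = formalTaylor (fun j => zeroExt ((fderivation I)^[j] c).1 v) W 0 := by
  have hc : PowerSeries.constantCoeff (PowerSeries.C v + PowerSeries.X * W) = v := by simp
  have hs : PowerSeries.HasSubst (PowerSeries.X * W) :=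
    PowerSeries.HasSubst.of_constantCoeff_zero' (by simp)
  rw [taylorComp, hc, add_sub_cancel_left]
  ext N
  rw [PowerSeries.coeff_subst' hs, formalTaylor, coeff_collapse]
  have hzero : ∀ j, N < j → PowerSeries.coeff N ((PowerSeries.X * W) ^ j) = 0 := fun j hj => by
    rw [mul_pow]
    exact PowerSeries.X_pow_dvd_iff.1 (dvd_mul_right _ _) N hj
  rw [finsum_eq_sum_of_support_subset (s := Finset.range (N + 1)),
    Finset.Nat.sum_antidiagonal_eq_sum_range_succ_mk]
  · refine Finset.sum_congr rfl fun j hj => ?_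
    rw [Finset.mem_range, Nat.lt_succ_iff] at hj
    rw [mul_pow, PowerSeries.coeff_mk, PowerSeries.coeff_smul, PowerSeries.coeff_C_mul,
      ← Nat.sub_add_cancel hj, PowerSeries.coeff_X_pow_mul, Nat.sub_add_cancel hj, zero_add,
      Rat.smul_def]
    push_cast
    rw [smul_eq_mul]
    ring
  · intro j hj
    rw [Finset.coe_range, Set.mem_Iio, Nat.lt_succ_iff]
    by_contra hcon
    exact hj (by simp only [hzero j (not_le.1 hcon), smul_zero])

theorem zeroExt_add (a b : SmoothFun I) (x : ℝ) :
    zeroExt (a + b).1 x = zeroExt a.1 x + zeroExt b.1 x := by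
  by_cases hx : x ∈ I
  · exact (zeroExt_apply _ ⟨x, hx⟩).trans (congrArg₂ (· + ·) (zeroExt_apply a.1 ⟨x, hx⟩).symm
      (zeroExt_apply b.1 ⟨x, hx⟩).symm)
  · have h : ∀ g : I → ℝ, zeroExt g x = 0 := fun g => Function.extend_apply' _ _ _ (by
      rintro ⟨y, rfl⟩
      exact hx y.2)
    rw [h, h, h, add_zero]

theorem exists_eq_C_add_X_mul (V : PowerSeries ℝ) :
    ∃ (v : ℝ) (W : PowerSeries ℝ), V = PowerSeries.C v + PowerSeries.X * W := by
  refine ⟨PowerSeries.constantCoeff V, PowerSeries.mk fun n => PowerSeries.coeff (n + 1) V, ?_⟩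
  rw [add_comm]
  exact PowerSeries.eq_X_mul_shift_add_const V

theorem taylorComp_add (a b : SmoothFun I) (V : PowerSeries ℝ) :
    taylorComp (a + b) V = taylorComp a V + taylorComp b V := by
  obtain ⟨v, W, rfl⟩ := exists_eq_C_add_X_mul V
  rw [taylorComp_eq, taylorComp_eq, taylorComp_eq, formalTaylor, formalTaylor, formalTaylor,
    ← collapse_add]
  congr 1
  funext j
  rw [iterate_map_add, zeroExt_add, map_add, add_mul, smul_add]

theorem taylorComp_zero (V : PowerSeries ℝ) : taylorComp (0 : SmoothFun I) V = 0 :=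
  map_zero (AddMonoidHom.mk' (fun a : SmoothFun I => taylorComp a V)
    fun a b => taylorComp_add a b V)

theorem evalDiffPoly_eq_sum {P : DiffPoly I} {s : Finset (ℕ →₀ ℕ)} (hs : P.support ⊆ s)
    (V : ℕ → PowerSeries ℝ) : evalDiffPoly P V
      = ∑ m ∈ s, taylorComp (P.coeff m) (V 0) * m.prod fun k e => V (k + 1) ^ e :=
  Finset.sum_subset hs fun m _ hm => by
    rw [MvPolynomial.notMem_support_iff.1 hm, taylorComp_zero, zero_mul]

theorem evalDiffPoly_add (P Q : DiffPoly I) (V : ℕ → PowerSeries ℝ) :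
    evalDiffPoly (P + Q) V = evalDiffPoly P V + evalDiffPoly Q V := by
  classical
  rw [evalDiffPoly_eq_sum (MvPolynomial.support_add (p := P) (q := Q)),
    evalDiffPoly_eq_sum (Finset.subset_union_left (s₂ := Q.support)),
    evalDiffPoly_eq_sum (Finset.subset_union_right (s₁ := P.support)), ← Finset.sum_add_distrib]
  refine Finset.sum_congr rfl fun m _ => ?_
  rw [MvPolynomial.coeff_add, taylorComp_add, add_mul]

/-- The value at a formal jet, as an additive map. -/
def evalDiffPolyHom (V : ℕ → PowerSeries ℝ) : DiffPoly I →+ PowerSeries ℝ :=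
  AddMonoidHom.mk' (fun P => evalDiffPoly P V) fun P Q => evalDiffPoly_add P Q V

theorem evalDiffPolyHom_apply (V : ℕ → PowerSeries ℝ) (P : DiffPoly I) :
    evalDiffPolyHom V P = evalDiffPoly P V := rfl

theorem evalDiffPolyHom_monomial (V : ℕ → PowerSeries ℝ) (m : ℕ →₀ ℕ) (c : SmoothFun I) :
    evalDiffPolyHom V (MvPolynomial.monomial m c)
      = taylorComp c (V 0) * m.prod fun k e => V (k + 1) ^ e := by
  classical
  rw [evalDiffPolyHom_apply, evalDiffPoly_eq_sum MvPolynomial.support_monomial_subset,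
    Finset.sum_singleton, MvPolynomial.coeff_monomial, if_pos rfl]

theorem evalDiffPolyHom_C (V : ℕ → PowerSeries ℝ) (c : SmoothFun I) :
    evalDiffPolyHom V (MvPolynomial.C c) = taylorComp c (V 0) := by
  rw [← MvPolynomial.monomial_zero', evalDiffPolyHom_monomial, Finsupp.prod_zero_index, mul_one]

theorem evalDiffPolyHom_mul_X (V : ℕ → PowerSeries ℝ) (P : DiffPoly I) (j : ℕ) :
    evalDiffPolyHom V (P * MvPolynomial.X j) = evalDiffPolyHom V P * V (j + 1) := by
  induction P using MvPolynomial.induction_on' with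
  | add p q hp hq => rw [add_mul, map_add, map_add, hp, hq, add_mul]
  | monomial m c =>
    rw [MvPolynomial.X, MvPolynomial.monomial_mul, mul_one, evalDiffPolyHom_monomial,
      evalDiffPolyHom_monomial, Finsupp.prod_add_index' (fun _ => pow_zero _)
        (fun _ _ _ => pow_add _ _ _), Finsupp.prod_single_index (h := fun k e => V (k + 1) ^ e)
        (pow_zero _), pow_one, mul_assoc]

theorem addMonoidHom_rat_smul {S M : Type*} [CommRing S] [Algebra ℚ S] [AddCommGroup M] [Module ℚ M]
    (φ : S →+ M) (r : ℚ) (a : S) : φ (r • a) = r • φ a := map_rat_smul φ r a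

theorem evalDiffPolyHom_omega (f : SmoothFun I) (V : ℕ → PowerSeries ℝ) (n k : ℕ) :
    evalDiffPolyHom V (omega (coeffSeq f)
        (scaledJet (totalDerivation I) (MvPolynomial.C (idFun I))) n k)
      = omega (fun k => taylorComp ((fderivation I)^[k] f) (V 0))
        (fun j => ((j + 1).factorial : ℚ)⁻¹ • V j) n k := by
  induction n using Nat.strong_induction_on generalizing k with
  | _ n ih =>
    cases n with
    | zero => rw [omega_zero, omega_zero, coeffSeq, evalDiffPolyHom_C]
    | succ n =>
      rw [omega_succ_eq, omega_succ_eq, addMonoidHom_rat_smul (S := DiffPoly I), map_sum]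
      congr 1
      refine Finset.sum_congr rfl fun x hx => ?_
      rw [mem_antidiagonal] at hx
      rw [addMonoidHom_rat_smul (S := DiffPoly I), scaledJet, coe_totalDerivation,
        iterate_totalDeriv_u, mul_smul_comm, addMonoidHom_rat_smul (S := DiffPoly I),
        evalDiffPolyHom_mul_X, ih x.1 (by omega), mul_smul_comm]

/-- The value of the deformed 1-form at the formal jet `V`. -/
theorem evalForm_deformedForm (f : SmoothFun I) (V : ℕ → PowerSeries ℝ) :
    evalForm (deformedForm f) V
      = collapse fun n => omega (fun k => taylorComp ((fderivation I)^[k] f) (V 0))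
        (fun j => ((j + 1).factorial : ℚ)⁻¹ • V j) n 0 := by
  simp only [← evalDiffPolyHom_omega]
  rfl

/-! ### Derivatives of functions of `(x, t)` and of `u` -/

section Partial

variable {U : Set (ℝ × ℝ)} {g h : ℝ × ℝ → ℝ} {p : ℝ × ℝ}

theorem hasDerivAt_curve_x (p : ℝ × ℝ) :
    HasDerivAt (fun s : ℝ => ((s, p.2) : ℝ × ℝ)) (1, 0) p.1 :=
  (hasDerivAt_id p.1).prodMk (hasDerivAt_const p.1 p.2)

theorem hasDerivAt_curve_t (p : ℝ × ℝ) :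
    HasDerivAt (fun s : ℝ => ((p.1, s) : ℝ × ℝ)) (0, 1) p.2 :=
  (hasDerivAt_const p.2 p.1).prodMk (hasDerivAt_id p.2)

theorem hasDerivAt_x_fderiv (hU : IsOpen U) (hg : ContDiffOn ℝ ∞ g U) (hp : p ∈ U) :
    HasDerivAt (fun s => g (s, p.2)) (fderiv ℝ g p (1, 0)) p.1 :=
  (((hg.contDiffAt (hU.mem_nhds hp)).differentiableAt (by simp)).hasFDerivAt).comp_hasDerivAt p.1
    (hasDerivAt_curve_x p)

theorem hasDerivAt_x (hU : IsOpen U) (hg : ContDiffOn ℝ ∞ g U) (hp : p ∈ U) :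
    HasDerivAt (fun s => g (s, p.2)) (dx g p) p.1 :=
  (hasDerivAt_x_fderiv hU hg hp).differentiableAt.hasDerivAt

theorem hasDerivAt_t (hU : IsOpen U) (hg : ContDiffOn ℝ ∞ g U) (hp : p ∈ U) :
    HasDerivAt (fun s => g (p.1, s)) (dt g p) p.2 := by
  have h : HasDerivAt (fun s => g (p.1, s)) (fderiv ℝ g p (0, 1)) p.2 :=
    (((hg.contDiffAt (hU.mem_nhds hp)).differentiableAt (by simp)).hasFDerivAt).comp_hasDerivAt p.2
      (hasDerivAt_curve_t p)
  exact h.differentiableAt.hasDerivAt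

theorem contDiffOn_dx (hU : IsOpen U) (hg : ContDiffOn ℝ ∞ g U) : ContDiffOn ℝ ∞ (dx g) U := by
  have h : ContDiffOn ℝ ∞ (fun q => fderiv ℝ g q (1, 0)) U :=
    (hg.fderiv_of_isOpen hU (by simp)).clm_apply contDiffOn_const
  exact h.congr fun q hq => (hasDerivAt_x_fderiv hU hg hq).deriv

theorem eventually_mem_x (hU : IsOpen U) (hp : p ∈ U) : ∀ᶠ s in nhds p.1, (s, p.2) ∈ U :=
  (hasDerivAt_curve_x p).continuousAt.eventually (hU.mem_nhds hp)

theorem eventually_mem_t (hU : IsOpen U) (hp : p ∈ U) : ∀ᶠ s in nhds p.2, (p.1, s) ∈ U :=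
  (hasDerivAt_curve_t p).continuousAt.eventually (hU.mem_nhds hp)

theorem dx_congr (hU : IsOpen U) (hgh : Set.EqOn g h U) : Set.EqOn (dx g) (dx h) U := fun _ hp =>
  Filter.EventuallyEq.deriv_eq ((eventually_mem_x hU hp).mono fun _ hs => hgh hs)

theorem dt_congr (hU : IsOpen U) (hgh : Set.EqOn g h U) : Set.EqOn (dt g) (dt h) U := fun _ hp =>
  Filter.EventuallyEq.deriv_eq ((eventually_mem_t hU hp).mono fun _ hs => hgh hs)

end Partial

theorem hasDerivAt_zeroExt (c : SmoothFun I) {y : ℝ} (hy : y ∈ I) :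
    HasDerivAt (zeroExt c.1) (zeroExt (fderivation I c).1 y) y := by
  rw [show zeroExt (fderivation I c).1 y = deriv (zeroExt c.1) y from zeroExt_apply _ ⟨y, hy⟩]
  exact (differentiableAt_zeroExt c ⟨y, hy⟩).hasDerivAt

/-- `u` is a smooth solution on `U`, with values in `I`, of the hodograph equation
`x + 2ut + f(u) = 0`. -/
structure IsHodographSolution (f : SmoothFun I) (U : Set (ℝ × ℝ)) (u : ℝ × ℝ → ℝ) : Prop where
  isOpen : IsOpen U
  contDiffOn : ContDiffOn ℝ ∞ u U
  mem : ∀ p ∈ U, u p ∈ I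
  equation : ∀ p ∈ U, p.1 + 2 * u p * p.2 + zeroExt f.1 (u p) = 0

namespace IsHodographSolution

variable {f : SmoothFun I} {U : Set (ℝ × ℝ)} {u : ℝ × ℝ → ℝ} {p : ℝ × ℝ}

theorem hasDerivAt_comp_x (H : IsHodographSolution f U u) (hp : p ∈ U) (c : SmoothFun I) :
    HasDerivAt (fun s => zeroExt c.1 (u (s, p.2)))
      (zeroExt (fderivation I c).1 (u p) * dx u p) p.1 :=
  (hasDerivAt_zeroExt c (H.mem p hp)).comp p.1 (hasDerivAt_x H.isOpen H.contDiffOn hp)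

theorem hasDerivAt_comp_t (H : IsHodographSolution f U u) (hp : p ∈ U) (c : SmoothFun I) :
    HasDerivAt (fun s => zeroExt c.1 (u (p.1, s)))
      (zeroExt (fderivation I c).1 (u p) * dt u p) p.2 :=
  (hasDerivAt_zeroExt c (H.mem p hp)).comp p.2 (hasDerivAt_t H.isOpen H.contDiffOn hp)

theorem dx_mul (H : IsHodographSolution f U u) (hp : p ∈ U) :
    dx u p * (2 * p.2 + zeroExt (fderivation I f).1 (u p)) = -1 := by
  have h1 := (((hasDerivAt_id p.1).add (((hasDerivAt_x H.isOpen H.contDiffOn hp).const_mul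
    2).mul_const p.2)).add (H.hasDerivAt_comp_x hp f))
  have h2 := h1.unique ((hasDerivAt_const p.1 (0 : ℝ)).congr_of_eventuallyEq
    ((eventually_mem_x H.isOpen hp).mono fun s hs => H.equation _ hs))
  linear_combination h2

theorem dx_ne_zero (H : IsHodographSolution f U u) (hp : p ∈ U) : dx u p ≠ 0 := fun h => by
  have := H.dx_mul hp
  rw [h, zero_mul] at this
  norm_num at this

theorem dt_eq (H : IsHodographSolution f U u) (hp : p ∈ U) : dt u p = 2 * u p * dx u p := by
  have h1 := ((hasDerivAt_const p.2 p.1).add (((hasDerivAt_t H.isOpen H.contDiffOn hp).const_mul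
    2).mul (hasDerivAt_id p.2))).add (H.hasDerivAt_comp_t hp f)
  have h2 := h1.unique ((hasDerivAt_const p.2 (0 : ℝ)).congr_of_eventuallyEq
    ((eventually_mem_t H.isOpen hp).mono fun s hs => H.equation _ hs))
  simp only [id] at h2
  linear_combination -dx u p * h2 + dt u p * H.dx_mul hp

theorem dx_dx (H : IsHodographSolution f U u) (hp : p ∈ U) :
    dx (dx u) p = zeroExt (fderivation I (fderivation I f)).1 (u p) * dx u p ^ 3 := by
  have h1 := (hasDerivAt_x H.isOpen (contDiffOn_dx H.isOpen H.contDiffOn) hp).mul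
    ((H.hasDerivAt_comp_x hp (fderivation I f)).const_add (2 * p.2))
  have h2 := h1.unique ((hasDerivAt_const p.1 (-1 : ℝ)).congr_of_eventuallyEq
    ((eventually_mem_x H.isOpen hp).mono fun s hs => H.dx_mul hs))
  linear_combination -dx u p * h2 + dx (dx u) p * H.dx_mul hp

theorem dt_dx (H : IsHodographSolution f U u) (hp : p ∈ U) : dt (dx u) p = 2 * dx u p ^ 2
    + 2 * u p * (zeroExt (fderivation I (fderivation I f)).1 (u p) * dx u p ^ 3) := by
  have h1 := (hasDerivAt_t H.isOpen (contDiffOn_dx H.isOpen H.contDiffOn) hp).mul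
    (((hasDerivAt_id p.2).const_mul 2).add (H.hasDerivAt_comp_t hp (fderivation I f)))
  have h2 := h1.unique ((hasDerivAt_const p.2 (-1 : ℝ)).congr_of_eventuallyEq
    ((eventually_mem_t H.isOpen hp).mono fun s hs => H.dx_mul hs))
  simp only [id, H.dt_eq hp, Pi.add_apply] at h2
  linear_combination -dx u p * h2 + dt (dx u) p * H.dx_mul hp

end IsHodographSolution

/-- The value at `p` of the coefficient variables `u, f(u), f'(u), …`. -/
def jetValue (f : SmoothFun I) (u : ℝ × ℝ → ℝ) (p : ℝ × ℝ) : ℕ → ℝ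
  | 0 => u p
  | k + 1 => zeroExt ((fderivation I)^[k] f).1 (u p)

/-- The value at `p` of an element of `ℚ[u, f, f', …][u_x]`. -/
def hodoEval (f : SmoothFun I) (u : ℝ × ℝ → ℝ) (p : ℝ × ℝ) : HodoPoly →+* ℝ :=
  Polynomial.eval₂RingHom
    (MvPolynomial.aeval (jetValue f u p) : MvPolynomial ℕ ℚ →ₐ[ℚ] ℝ).toRingHom (dx u p)

section HodoEval

variable {f : SmoothFun I} {U : Set (ℝ × ℝ)} {u : ℝ × ℝ → ℝ} {p : ℝ × ℝ}

theorem hodoEval_C (a : MvPolynomial ℕ ℚ) :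
    hodoEval f u p (Polynomial.C a) = MvPolynomial.aeval (jetValue f u p) a :=
  Polynomial.eval₂_C _ _

theorem hodoEval_X : hodoEval f u p Polynomial.X = dx u p := Polynomial.eval₂_X _ _

theorem hodoEval_uVar : hodoEval f u p uVar = u p := by
  rw [uVar, hodoEval_C, MvPolynomial.aeval_X]
  rfl

theorem hodoEval_fVar (k : ℕ) :
    hodoEval f u p (fVar k) = zeroExt ((fderivation I)^[k] f).1 (u p) := by
  rw [fVar, hodoEval_C, MvPolynomial.aeval_X]
  rfl

theorem hasDerivAt_hodoEval {D : RatDerivation HodoPoly} {γ : ℝ → ℝ × ℝ} {s : ℝ}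
    (hX : HasDerivAt (fun r => dx u (γ r)) (hodoEval f u (γ s) (D Polynomial.X)) s)
    (hu : HasDerivAt (fun r => u (γ r)) (hodoEval f u (γ s) (D uVar)) s)
    (hf : ∀ k, HasDerivAt (fun r => zeroExt ((fderivation I)^[k] f).1 (u (γ r)))
      (hodoEval f u (γ s) (D (fVar k))) s) (P : HodoPoly) :
    HasDerivAt (fun r => hodoEval f u (γ r) P) (hodoEval f u (γ s) (D P)) s := by
  have hmul : ∀ P Q : HodoPoly,
      HasDerivAt (fun r => hodoEval f u (γ r) P) (hodoEval f u (γ s) (D P)) s →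
      HasDerivAt (fun r => hodoEval f u (γ r) Q) (hodoEval f u (γ s) (D Q)) s →
      HasDerivAt (fun r => hodoEval f u (γ r) (P * Q)) (hodoEval f u (γ s) (D (P * Q))) s := by
    intro P Q hP hQ
    rw [Derivation.leibniz, map_add, smul_eq_mul, smul_eq_mul, map_mul, map_mul]
    simp only [map_mul]
    exact (hP.fun_mul hQ).congr_deriv (by ring)
  have hadd : ∀ P Q : HodoPoly,
      HasDerivAt (fun r => hodoEval f u (γ r) P) (hodoEval f u (γ s) (D P)) s →
      HasDerivAt (fun r => hodoEval f u (γ r) Q) (hodoEval f u (γ s) (D Q)) s →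
      HasDerivAt (fun r => hodoEval f u (γ r) (P + Q)) (hodoEval f u (γ s) (D (P + Q))) s := by
    intro P Q hP hQ
    simp only [map_add]
    exact hP.add hQ
  have hX' : HasDerivAt (fun r => hodoEval f u (γ r) Polynomial.X)
      (hodoEval f u (γ s) (D Polynomial.X)) s := by
    simpa only [hodoEval_X] using hX
  have hC : ∀ a : MvPolynomial ℕ ℚ, HasDerivAt (fun r => hodoEval f u (γ r) (Polynomial.C a))
      (hodoEval f u (γ s) (D (Polynomial.C a))) s := by
    intro a
    induction a using MvPolynomial.induction_on with
    | C r =>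
      have h1 : (Polynomial.C (MvPolynomial.C r) : HodoPoly) = algebraMap ℚ HodoPoly r := rfl
      simp only [hodoEval_C, MvPolynomial.aeval_C]
      rw [h1, Derivation.map_algebraMap, map_zero]
      exact hasDerivAt_const _ _
    | add a b ha hb => rw [map_add]; exact hadd _ _ ha hb
    | mul_X a k ha =>
      rw [map_mul]
      refine hmul _ _ ha ?_
      cases k with
      | zero =>
        simp only [← hodoEval_uVar (f := f) (u := u)] at hu
        exact hu
      | succ k =>
        have hk := hf k
        simp only [← hodoEval_fVar] at hk
        exact hk
  induction P using Polynomial.induction_on with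
  | C a => exact hC a
  | add p q hp hq => exact hadd p q hp hq
  | monomial n a h =>
    rw [pow_succ, ← mul_assoc]
    exact hmul _ _ h hX'

namespace IsHodographSolution

theorem hasDerivAt_hodoEval_x (H : IsHodographSolution f U u) (hp : p ∈ U) (P : HodoPoly) :
    HasDerivAt (fun s => hodoEval f u (s, p.2) P) (hodoEval f u p (fullDx P)) p.1 := by
  refine hasDerivAt_hodoEval (γ := fun s => (s, p.2)) (s := p.1) ?_ ?_ (fun k => ?_) P
  · rw [fullDx_X, map_mul, map_pow, hodoEval_fVar, hodoEval_X, Function.iterate_succ_apply',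
      Function.iterate_one, ← H.dx_dx hp]
    exact hasDerivAt_x H.isOpen (contDiffOn_dx H.isOpen H.contDiffOn) hp
  · rw [fullDx_uVar, hodoEval_X]
    exact hasDerivAt_x H.isOpen H.contDiffOn hp
  · rw [fullDx_fVar, map_mul, hodoEval_fVar, hodoEval_X, Function.iterate_succ_apply']
    exact H.hasDerivAt_comp_x hp _

theorem hasDerivAt_hodoEval_t (H : IsHodographSolution f U u) (hp : p ∈ U) (P : HodoPoly) :
    HasDerivAt (fun s => hodoEval f u (p.1, s) P) (hodoEval f u p (fullDt P)) p.2 := by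
  refine hasDerivAt_hodoEval (γ := fun s => (p.1, s)) (s := p.2) ?_ ?_ (fun k => ?_) P
  · rw [fullDt_apply, fullDx_X, hodoTransport_X]
    simp only [map_add, map_mul, map_pow, map_ofNat, hodoEval_fVar, hodoEval_X, hodoEval_uVar,
      Function.iterate_succ_apply', Function.iterate_zero, id]
    rw [← H.dt_dx hp]
    exact hasDerivAt_t H.isOpen (contDiffOn_dx H.isOpen H.contDiffOn) hp
  · rw [fullDt_uVar]
    simp only [map_mul, map_ofNat, hodoEval_X, hodoEval_uVar]
    rw [← H.dt_eq hp]
    exact hasDerivAt_t H.isOpen H.contDiffOn hp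
  · rw [fullDt_fVar]
    simp only [map_mul, map_ofNat, hodoEval_X, hodoEval_uVar, hodoEval_fVar,
      Function.iterate_succ_apply']
    rw [← H.dt_eq hp]
    exact H.hasDerivAt_comp_t hp _

theorem dx_hodoEval (H : IsHodographSolution f U u) (hp : p ∈ U) (P : HodoPoly) :
    dx (fun q => hodoEval f u q P) p = hodoEval f u p (fullDx P) :=
  (H.hasDerivAt_hodoEval_x hp P).deriv

theorem dt_hodoEval (H : IsHodographSolution f U u) (hp : p ∈ U) (P : HodoPoly) :
    dt (fun q => hodoEval f u q P) p = hodoEval f u p (fullDt P) :=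
  (H.hasDerivAt_hodoEval_t hp P).deriv

theorem iterate_dx_eq (H : IsHodographSolution f U u) {g : ℝ × ℝ → ℝ} {P : HodoPoly}
    (hg : Set.EqOn g (fun q => hodoEval f u q P) U) (k : ℕ) :
    Set.EqOn (dx^[k] g) (fun q => hodoEval f u q (fullDx^[k] P)) U := by
  induction k with
  | zero => exact hg
  | succ k ih =>
    intro q hq
    simp only [Function.iterate_succ_apply']
    rw [dx_congr H.isOpen ih hq, H.dx_hodoEval hq]

theorem contDiffOn_hodoEval (H : IsHodographSolution f U u) (P : HodoPoly) :
    ContDiffOn ℝ ∞ (fun q => hodoEval f u q P) U := by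
  have hC : ∀ a : MvPolynomial ℕ ℚ,
      ContDiffOn ℝ ∞ (fun q => hodoEval f u q (Polynomial.C a)) U := by
    intro a
    induction a using MvPolynomial.induction_on with
    | C r => simp only [hodoEval_C, MvPolynomial.aeval_C]; exact contDiffOn_const
    | add a b ha hb => simp only [map_add]; exact ha.add hb
    | mul_X a k ha =>
      simp only [map_mul]
      refine ha.mul ?_
      cases k with
      | zero => exact H.contDiffOn.congr fun q _ => hodoEval_uVar
      | succ k =>
        refine ContDiffOn.congr (f := fun q => zeroExt ((fderivation I)^[k] f).1 (u q)) ?_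
          fun q _ => hodoEval_fVar k
        exact ContDiffOn.comp ((fderivation I)^[k] f).2 H.contDiffOn fun q hq => H.mem q hq
  induction P using Polynomial.induction_on with
  | C a => exact hC a
  | add p q hp hq => simp only [map_add]; exact hp.add hq
  | monomial n a h =>
    simp only [pow_succ, ← mul_assoc, map_mul _ (_ * _), hodoEval_X]
    exact h.mul (contDiffOn_dx H.isOpen H.contDiffOn)

end IsHodographSolution
end HodoEval

/-! ### Values of the quasi-Miura series -/

/-- The values at `p` of the jet variables `1/u_x, u_x, u_xx, …`. -/
def jetPoint (u : ℝ × ℝ → ℝ) (p : ℝ × ℝ) (k : ℕ) : ℝ := if k = 0 then (dx u p)⁻¹ else dx^[k] u p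

namespace IsHodographSolution

variable {f : SmoothFun I} {U : Set (ℝ × ℝ)} {u : ℝ × ℝ → ℝ} {p : ℝ × ℝ}

theorem eqOn_u (f : SmoothFun I) (U : Set (ℝ × ℝ)) (u : ℝ × ℝ → ℝ) :
    Set.EqOn u (fun q => hodoEval f u q uVar) U := fun _ _ => hodoEval_uVar.symm

theorem hasDerivAt_jetPoint (H : IsHodographSolution f U u) (hp : p ∈ U)
    (P : MvPolynomial ℕ ℚ) : HasDerivAt (fun s => MvPolynomial.aeval (jetPoint u (s, p.2)) P)
      (MvPolynomial.aeval (jetPoint u p) (jetDx P)) p.1 := by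
  have hk : ∀ k, HasDerivAt (fun s => dx^[k] u (s, p.2)) (dx^[k + 1] u p) p.1 := fun k => by
    have hsm : ContDiffOn ℝ ∞ (dx^[k] u) U :=
      (H.contDiffOn_hodoEval _).congr (H.iterate_dx_eq (eqOn_u f U u) k)
    rw [Function.iterate_succ_apply']
    exact hasDerivAt_x H.isOpen hsm hp
  induction P using MvPolynomial.induction_on with
  | C r =>
    simp only [MvPolynomial.aeval_C]
    rw [jetDx, MvPolynomial.derivation_C, map_zero]
    exact hasDerivAt_const _ _
  | add P Q hP hQ =>
    simp only [map_add]
    exact hP.add hQ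
  | mul_X P k hP =>
    rw [Derivation.leibniz, map_add, smul_eq_mul, smul_eq_mul, map_mul, map_mul]
    simp only [map_mul]
    have hX : HasDerivAt (fun s => MvPolynomial.aeval (jetPoint u (s, p.2))
        (MvPolynomial.X k : MvPolynomial ℕ ℚ))
        (MvPolynomial.aeval (jetPoint u p) (jetDx (MvPolynomial.X k : MvPolynomial ℕ ℚ))) p.1 := by
      rw [jetDx, MvPolynomial.mkDerivation_X]
      simp only [MvPolynomial.aeval_X, jetPoint]
      split_ifs with h0
      · refine ((hk 1).fun_inv (H.dx_ne_zero hp)).congr_deriv ?_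
        rw [map_neg, map_mul, map_pow, MvPolynomial.aeval_X, MvPolynomial.aeval_X]
        simp only [jetPoint, if_true, if_neg (two_ne_zero' ℕ), Function.iterate_one]
        field_simp
      · refine (hk k).congr_deriv ?_
        rw [MvPolynomial.aeval_X, jetPoint, if_neg (Nat.succ_ne_zero k)]
    exact (hP.fun_mul hX).congr_deriv (by ring)

/-- The elimination of `f'', f''', …` is undone at the derivatives of `u`, as `u_xx = f''(u) u_x^3`. -/
theorem aeval_elimF (H : IsHodographSolution f U u) (k : ℕ) (hp : p ∈ U) :
    MvPolynomial.aeval (jetPoint u p) (elimF k)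
      = zeroExt ((fderivation I)^[k + 2] f).1 (u p) := by
  have hne := H.dx_ne_zero hp
  induction k generalizing p with
  | zero =>
    rw [elimF, map_mul, map_pow, MvPolynomial.aeval_X, MvPolynomial.aeval_X]
    simp only [jetPoint, if_true, if_neg (two_ne_zero' ℕ), Function.iterate_succ_apply',
      Function.iterate_zero, id]
    rw [H.dx_dx hp]
    field_simp
  | succ k ih =>
    have h1 := (H.hasDerivAt_comp_x hp ((fderivation I)^[k + 2] f)).congr_of_eventuallyEq
      ((eventually_mem_x H.isOpen hp).mono fun s hs => ih hs (H.dx_ne_zero hs))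
    have h2 := (H.hasDerivAt_jetPoint hp (elimF k)).unique h1
    rw [elimF, map_mul, h2, MvPolynomial.aeval_X, jetPoint, if_pos rfl,
      ← Function.iterate_succ_apply' (fderivation I)]
    field_simp

theorem aeval_quasiMiura (H : IsHodographSolution f U u) (hp : p ∈ U) (P : HodoPoly) :
    MvPolynomial.aeval (jetPoint u p) (P.eval₂
      (MvPolynomial.aeval elimF : MvPolynomial ℕ ℚ →ₐ[ℚ] MvPolynomial ℕ ℚ).toRingHom
      (MvPolynomial.X 1)) = hodoEval f u p (hodoInclusion P) := by
  have hC : ∀ a : MvPolynomial ℕ ℚ, MvPolynomial.aeval (jetPoint u p) (MvPolynomial.aeval elimF a)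
      = hodoEval f u p (Polynomial.C (MvPolynomial.rename (· + 3) a)) := by
    intro a
    rw [hodoEval_C, MvPolynomial.aeval_rename, ← AlgHom.comp_apply, MvPolynomial.comp_aeval]
    congr 2
    funext k
    rw [H.aeval_elimF k hp]
    rfl
  induction P using Polynomial.induction_on' with
  | add P Q hP hQ => rw [Polynomial.eval₂_add, map_add, map_add, map_add, hP, hQ]
  | monomial n a =>
    have hI : hodoInclusion (Polynomial.monomial n a)
        = Polynomial.C (MvPolynomial.rename (· + 3) a) * Polynomial.X ^ n := by
      rw [Polynomial.C_mul_X_pow_eq_monomial]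
      exact Polynomial.map_monomial _
    rw [Polynomial.eval₂_monomial, hI, map_mul, map_mul, map_pow, map_pow, hodoEval_X,
      MvPolynomial.aeval_X, ← hC, jetPoint, if_neg one_ne_zero]
    rfl

theorem quasiMiuraSeries_eq (H : IsHodographSolution f U u) (n : ℕ) :
    Set.EqOn (quasiMiuraSeries u n) (fun q => hodoEval f u q (quasiMiuraCoeff n)) U := by
  intro q hq
  cases n with
  | zero => exact eqOn_u f U u hq
  | succ n => exact H.aeval_quasiMiura hq _

theorem isFormalBurgersSolution (H : IsHodographSolution f U u) :
    IsFormalBurgersSolution U (quasiMiuraSeries u) := by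
  refine ⟨fun n => (H.contDiffOn_hodoEval _).congr (H.quasiMiuraSeries_eq n), fun n p hp => ?_⟩
  rw [dt_congr H.isOpen (H.quasiMiuraSeries_eq n) hp, H.dt_hodoEval hp, fullDt_quasiMiuraCoeff,
    ← H.dx_hodoEval hp]
  refine (dx_congr H.isOpen (fun q hq => ?_) hp).symm
  rw [map_add, map_sum]
  congr 1
  · refine Finset.sum_congr rfl fun x _ => ?_
    rw [H.quasiMiuraSeries_eq _ hq, H.quasiMiuraSeries_eq _ hq, map_mul]
  · split_ifs with h0
    · rw [map_zero]
    · rw [dx_congr H.isOpen (H.quasiMiuraSeries_eq _) hq, H.dx_hodoEval hq]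

theorem map_formalMiura (H : IsHodographSolution f U u) (hp : p ∈ U) (k : ℕ) :
    formalJet (quasiMiuraSeries u) p k
      = PowerSeries.map (hodoEval f u p) ((seriesDerivation fullDx)^[k] formalMiura) := by
  ext n
  rw [PowerSeries.coeff_map, coeff_iterate_seriesDerivation, formalMiura, PowerSeries.coeff_mk,
    formalJet, PowerSeries.coeff_mk]
  exact H.iterate_dx_eq (H.quasiMiuraSeries_eq n) k hp

theorem formalJet_zero_eq (H : IsHodographSolution f U u) (hp : p ∈ U) :
    formalJet (quasiMiuraSeries u) p 0 = PowerSeries.C (u p) + PowerSeries.X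
      * (PowerSeries.C (dx u p) * PowerSeries.map (hodoEval f u p) reducedMiura) := by
  rw [H.map_formalMiura hp, Function.iterate_zero, id, formalMiura_eq, map_add, map_mul, map_mul,
    PowerSeries.map_C, PowerSeries.map_C, PowerSeries.map_X, hodoEval_uVar, hodoEval_X]

theorem map_formalTaylor {A B : Type*} [CommRing A] [Algebra ℚ A] [CommRing B] [Algebra ℚ B]
    (φ : A →+* B) (c : ℕ → A) (W : PowerSeries A) (k : ℕ) :
    PowerSeries.map φ (formalTaylor c W k)
      = formalTaylor (fun j => φ (c j)) (PowerSeries.map φ W) k := by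
  rw [formalTaylor, formalTaylor, map_collapse]
  congr 1
  funext j
  rw [map_rat_smul, map_mul, map_pow, PowerSeries.map_C]

theorem evalForm_eq_map (H : IsHodographSolution f U u) (hp : p ∈ U) :
    evalForm (deformedForm f) (formalJet (quasiMiuraSeries u) p)
      = PowerSeries.map (hodoEval f u p) formalOmega := by
  have hc : ∀ k, taylorComp ((fderivation I)^[k] f) (formalJet (quasiMiuraSeries u) p 0)
      = PowerSeries.map (hodoEval f u p) (formalCoeffSeq k) := by
    intro k
    rw [H.formalJet_zero_eq hp, taylorComp_eq, formalCoeffSeq, map_formalTaylor, formalTaylor,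
      formalTaylor, map_mul, PowerSeries.map_C, hodoEval_X]
    simp only [hodoEval_fVar, ← Function.iterate_add_apply, add_comm, add_zero]
  have hz : ∀ j, ((j + 1).factorial : ℚ)⁻¹ • formalJet (quasiMiuraSeries u) p j
      = PowerSeries.map (hodoEval f u p) (scaledJet (seriesDerivation fullDx) formalMiura j) := by
    intro j
    rw [H.map_formalMiura hp, scaledJet, map_rat_smul]
  rw [evalForm_deformedForm, formalOmega, omegaSeries, map_collapse]
  simp only [hc, hz, map_omega]

theorem deformed_hodograph (H : IsHodographSolution f U u) (hp : p ∈ U) :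
    PowerSeries.C p.1 + PowerSeries.C (2 * p.2) * formalJet (quasiMiuraSeries u) p 0
      + evalForm (deformedForm f) (formalJet (quasiMiuraSeries u) p) = 0 := by
  have h1 := congrArg (PowerSeries.map (hodoEval f u p)) formalHodograph_eq_zero
  rw [formalHodograph, map_sub, map_sub, map_sub, ← H.evalForm_eq_map hp] at h1
  simp only [map_mul, map_zero, PowerSeries.map_C, PowerSeries.map_X, hodoEval_X,
    hodoEval_fVar] at h1
  have h2 := congrArg (PowerSeries.C (R := ℝ)) (H.equation p hp)
  have h3 := congrArg (PowerSeries.C (R := ℝ)) (H.dx_mul hp)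
  simp only [map_add, map_mul, map_zero, map_neg, map_one, map_ofNat] at h2 h3
  simp only [Function.iterate_zero, Function.iterate_one, id] at h1
  rw [H.formalJet_zero_eq hp, map_mul, map_ofNat]
  linear_combination h1 + h2
    + PowerSeries.X * PowerSeries.map (hodoEval f u p) reducedMiura * h3

/-! ### The first terms on the hodograph locus -/

/-- On the hodograph locus the derivatives of `u` are polynomials in `u_x` with coefficients in
`ℚ[f'', f''', …]`. -/
theorem iterate_dx_u (H : IsHodographSolution f U u) (hp : p ∈ U) (k : ℕ) :
    dx^[k + 1] u p = hodoEval f u p (hodoInclusion (hodoDx^[k] Polynomial.X)) := by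
  have h : fullDx^[k + 1] uVar = hodoInclusion (hodoDx^[k] Polynomial.X) := by
    induction k with
    | zero => rw [Function.iterate_one, fullDx_uVar]; exact (Polynomial.map_X _).symm
    | succ k ih =>
      rw [Function.iterate_succ_apply', ih, Function.iterate_succ_apply', hodoInclusion_hodoDx]
  exact (H.iterate_dx_eq (eqOn_u f U u) (k + 1) hp).trans (congrArg _ h)

theorem hodoEval_inclusion_X :
    hodoEval f u p (hodoInclusion Polynomial.X) = dx u p := by
  rw [show hodoInclusion Polynomial.X = Polynomial.X from Polynomial.map_X _, hodoEval_X]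

theorem quasiMiuraSeries_eq_dx (H : IsHodographSolution f U u) {n : ℕ} {Φ : HodoPoly}
    (hΦ : hodoCorrection (n + 1) = hodoDx Φ) {g : ℝ × ℝ → ℝ}
    (hg : Set.EqOn g (fun q => hodoEval f u q (hodoInclusion Φ)) U) (hp : p ∈ U) :
    quasiMiuraSeries u (n + 1) p = dx g p := by
  rw [dx_congr H.isOpen hg hp, H.dx_hodoEval hp, ← hodoInclusion_hodoDx, ← hΦ]
  exact H.quasiMiuraSeries_eq (n + 1) hp

section Jets

open Polynomial

theorem hodoDx_iterate_two : hodoDx^[2] X = C (MvPolynomial.X 1) * X ^ 4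
    + (3 : ℚ) • (C (MvPolynomial.X 0) ^ 2 * X ^ 5) := by
  simp only [Function.iterate_succ_apply', Function.iterate_zero, id, hodoDx_mul, hodoDx_pow,
    hodoDx_C_X, hodoDx_X]
  push_cast
  algebra

theorem hodoDx_iterate_three : hodoDx^[3] X = C (MvPolynomial.X 2) * X ^ 5
    + (10 : ℚ) • (C (MvPolynomial.X 0) * C (MvPolynomial.X 1) * X ^ 6)
    + (15 : ℚ) • (C (MvPolynomial.X 0) ^ 3 * X ^ 7) := by
  rw [Function.iterate_succ_apply', hodoDx_iterate_two]
  simp only [hodoDx_add, hodoDx_smul, hodoDx_mul, hodoDx_pow, hodoDx_C_X, hodoDx_X]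
  push_cast
  algebra

theorem hodoDx_iterate_four : hodoDx^[4] X = C (MvPolynomial.X 3) * X ^ 6
    + (15 : ℚ) • (C (MvPolynomial.X 0) * C (MvPolynomial.X 2) * X ^ 7)
    + (10 : ℚ) • (C (MvPolynomial.X 1) ^ 2 * X ^ 7)
    + (105 : ℚ) • (C (MvPolynomial.X 0) ^ 2 * C (MvPolynomial.X 1) * X ^ 8)
    + (105 : ℚ) • (C (MvPolynomial.X 0) ^ 4 * X ^ 9) := by
  rw [Function.iterate_succ_apply', hodoDx_iterate_three]
  simp only [hodoDx_add, hodoDx_smul, hodoDx_mul, hodoDx_pow, hodoDx_C_X, hodoDx_X]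
  push_cast
  algebra

end Jets

theorem quasiMiuraSeries_one (H : IsHodographSolution f U u) (hp : p ∈ U) :
    quasiMiuraSeries u 1 p = dx^[2] u p / (2 * dx u p) := by
  have hne := H.dx_ne_zero hp
  rw [H.iterate_dx_u hp 1, Function.iterate_one, hodoDx_X, H.quasiMiuraSeries_eq 1 hp,
    quasiMiuraCoeff, hodoCorrection_one]
  simp only [map_rat_smul, map_mul, map_pow, hodoEval_inclusion_X, Rat.smul_def]
  push_cast
  field_simp

theorem quasiMiuraSeries_two (H : IsHodographSolution f U u) (hp : p ∈ U) :
    quasiMiuraSeries u 2 p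
      = dx (fun q => dx^[3] u q / (8 * dx u q ^ 2) - dx^[2] u q ^ 2 / (6 * dx u q ^ 3)) p := by
  refine H.quasiMiuraSeries_eq_dx hodoCorrection_two (fun q hq => ?_) hp
  have hne := H.dx_ne_zero hq
  simp only [H.iterate_dx_u hq]
  rw [hodoDx_iterate_two, Function.iterate_one, hodoDx_X, secondPotential]
  simp only [map_rat_smul, map_add, map_mul, map_pow, hodoEval_inclusion_X, Rat.smul_def]
  push_cast
  field_simp
  ring

theorem quasiMiuraSeries_three (H : IsHodographSolution f U u) (hp : p ∈ U) :
    quasiMiuraSeries u 3 p = dx (fun q => dx^[5] u q / (48 * dx u q ^ 3)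
          - dx^[2] u q * dx^[4] u q / (6 * dx u q ^ 4)
          - dx^[3] u q ^ 2 / (8 * dx u q ^ 4)
          + 3 * dx^[2] u q ^ 2 * dx^[3] u q / (4 * dx u q ^ 5)
          - dx^[2] u q ^ 4 / (2 * dx u q ^ 6)) p := by
  refine H.quasiMiuraSeries_eq_dx hodoCorrection_three (fun q hq => ?_) hp
  have hne := H.dx_ne_zero hq
  simp only [H.iterate_dx_u hq]
  rw [hodoDx_iterate_two, hodoDx_iterate_three, hodoDx_iterate_four, Function.iterate_one,
    hodoDx_X, thirdPotential]
  simp only [map_rat_smul, map_add, map_mul, map_pow, hodoEval_inclusion_X, Rat.smul_def]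
  push_cast
  field_simp
  ring

end IsHodographSolution

end

end BurgersHodograph

theorem mainTheorem9 (I : TopologicalSpace.Opens ℝ) (f : SmoothFun I)
    (U : Set (ℝ × ℝ)) (hU : IsOpen U) (u : ℝ × ℝ → ℝ) (hu : ContDiffOn ℝ ∞ u U)
    (huI : ∀ p ∈ U, u p ∈ I)
    (hodograph : ∀ p, ∀ hp : p ∈ U, p.1 + 2 * u p * p.2 + f.1 ⟨u p, huI p hp⟩ = 0) :
    -- the quasi-Miura transform of `u` is a formal solution of Burgers' equation
    IsFormalBurgersSolution U (quasiMiuraSeries u) ∧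
    -- its first terms
    (∀ p ∈ U,
      quasiMiuraSeries u 1 p = dx^[2] u p / (2 * dx u p) ∧
      quasiMiuraSeries u 2 p =
        dx (fun q => dx^[3] u q / (8 * dx u q ^ 2) - dx^[2] u q ^ 2 / (6 * dx u q ^ 3)) p ∧
      quasiMiuraSeries u 3 p =
        dx (fun q => dx^[5] u q / (48 * dx u q ^ 3)
          - dx^[2] u q * dx^[4] u q / (6 * dx u q ^ 4)
          - dx^[3] u q ^ 2 / (8 * dx u q ^ 4)
          + 3 * dx^[2] u q ^ 2 * dx^[3] u q / (4 * dx u q ^ 5)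
          - dx^[2] u q ^ 4 / (2 * dx u q ^ 6)) p) ∧
    -- the deformed 1-form of `f` exists and is unique
    (∃! w : FormalForm I, IsDeformedForm f w) ∧
    -- the deformed hodograph equation `x + 2vt + ω_f(v, v_x, …) = 0`, at every order
    ∀ w : FormalForm I, IsDeformedForm f w → ∀ p ∈ U,
      PowerSeries.C p.1 + PowerSeries.C (2 * p.2) * formalJet (quasiMiuraSeries u) p 0
        + evalForm w (formalJet (quasiMiuraSeries u) p) = 0 := by
  have H : IsHodographSolution f U u := ⟨hU, hu, huI, fun p hp => by
    have h := hodograph p hp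
    rwa [← zeroExt_apply f.1 ⟨u p, huI p hp⟩] at h⟩
  refine ⟨H.isFormalBurgersSolution, fun p hp => ⟨H.quasiMiuraSeries_one hp,
    H.quasiMiuraSeries_two hp, H.quasiMiuraSeries_three hp⟩, ⟨deformedForm f,
    isDeformedForm_deformedForm f, fun w hw => hw.unique (isDeformedForm_deformedForm f)⟩,
    fun w hw p hp => ?_⟩
  rw [hw.unique (isDeformedForm_deformedForm f)]
  exact H.deformed_hodograph hp
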